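/- Let $W_0:[-1/e,\infty)\to[-1,\infty)$ be the principal branch of the Lambert $W$ function, i.e. $X=W_0(Y)$ is the unique $X\ge -1$ with $Xe^X=Y$, and let $a:\mathbb R\to\mathbb C$ be a $C^\infty$ function with compact support. All double signs $\pm$ are taken in the same order. For $p>0$ and integers $k\ge 0$ put $$\tilde I^{\pm}_{p,k+1}:=\mathrm{Os}\text{-}\int_0^\infty e^{\pm i x^p}x^k\,dx:=\lim_{\varepsilon\to+0}\int_0^\infty e^{\pm i x^p}x^k\chi(\varepsilon x)\,dx\qquad(\chi\in\mathcal S(\mathbb R),\ \chi(0)=1).$$ This limit exists, is independent of $\chi$, and equals $p^{-1}e^{\pm i\frac{\pi}{2}\frac{k+1}{p}}\Gamma\big(\frac{k+1}{p}\big)$. For integers $m\ge1$, $k\ge0$ put $$c^{\pm}_{m,k}:=\tilde I^{\pm}_{m,k+1}+(-1)^k\,\tilde I^{\pm\pm^m}_{m,k+1},\qquad \tilde I^{\pm\pm^m}_{m,k+1}:=m^{-1}e^{\pm(-1)^m i\frac{\pi}{2}\frac{k+1}{m}}\Gamma\Big(\frac{k+1}{m}\Big).$$ For $p>0$, the map $\Phi(y)=pW_0(y/p)$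 is a $C^\infty$ bijection from $(-p/e,\infty)$ onto $(-p,\infty)$ with $\Phi(y)e^{\Phi(y)/p}=y$ and $\Phi'(y)=W_0'(y/p)$, and the following hold. (i) For every $p>0$ and every integer $N\ge 1$, as $\lambda\to\infty$, $$\int_0^\infty e^{\pm i\lambda x^pe^x}a(x)\,dx=\sum_{k=0}^{N-1}\frac{\tilde I^{\pm}_{p,k+1}}{k!}\Big(\frac{d}{dy}\Big)^k\Big|_{y=0}\Big\{a\big(pW_0(\tfrac yp)\big)\,W_0'(\tfrac yp)\Big\}\lambda^{-\frac{k+1}{p}}+O\Big(\lambda^{-\frac{N+1-(p-[p])}{p}}\Big),$$ where $[p]$ is the integer part of $p$. (ii) For every integer $m\ge1$ such that $\mathrm{supp}\,a\subset(-m,\infty)$ and every integer $N\ge1$, as $\lambda\to\infty$, $$\int_{-\infty}^\infty e^{\pm i\lambda x^me^x}a(x)\,dx=\sum_{k=0}^{N-1}\frac{c^{\pm}_{m,k}}{k!}\Big(\frac{d}{dy}\Big)^k\Big|_{y=0}\Big\{a\big(mW_0(\tfrac ym)\big)\,W_0'(\tfrac ym)\Big\}\lambda^{-\frac{k+1}{m}}+O\Big(\lambda^{-\frac{N+1}{m}}\Big).$$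 -/

import Mathlib

open Set Filter Topology Asymptotics
open scoped ContDiff

noncomputable section

/-- The principal branch `W₀` of the Lambert W function: for `y ≥ -1/e`, `lambertW0 y` is the unique
`x ≥ -1` with `x * exp x = y` (arbitrary values for `y < -1/e`); see `lambertW0_eq_iff`. -/
def lambertW0 (y : ℝ) : ℝ :=
  Function.invFunOn (fun x : ℝ => x * Real.exp x) (Ici (-1)) y

theorem strictMonoOn_mul_exp : StrictMonoOn (fun x : ℝ => x * Real.exp x) (Ici (-1)) := by
  refine strictMonoOn_of_deriv_pos (convex_Ici _) (by fun_prop) fun x hx => ?_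
  rw [interior_Ici] at hx
  have h : HasDerivAt (fun x : ℝ => x * Real.exp x) (1 * Real.exp x + x * Real.exp x) x :=
    (hasDerivAt_id x).mul (Real.hasDerivAt_exp x)
  rw [h.deriv, ← add_mul]
  exact mul_pos (by linarith [mem_Ioi.mp hx]) (Real.exp_pos x)

theorem exists_mul_exp_eq {y : ℝ} (hy : -Real.exp (-1) ≤ y) :
    ∃ x ∈ Ici (-1 : ℝ), x * Real.exp x = y := by
  have hM : (-1 : ℝ) ≤ max y 0 := le_trans (by norm_num) (le_max_right _ _)
  have hc : ContinuousOn (fun x : ℝ => x * Real.exp x) (Icc (-1) (max y 0)) := by fun_prop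
  have hup : y ≤ max y 0 * Real.exp (max y 0) :=
    (le_max_left y 0).trans
      (le_mul_of_one_le_right (le_max_right _ _) (Real.one_le_exp (le_max_right _ _)))
  obtain ⟨x, hx, hxy⟩ := intermediate_value_Icc hM hc ⟨by simpa using hy, hup⟩
  exact ⟨x, hx.1, hxy⟩

/-- On `y ≥ -1/e`, `lambertW0` is the inverse of `x ↦ x * exp x` with values `x ≥ -1`. -/
theorem lambertW0_eq_iff {y : ℝ} (hy : -Real.exp (-1) ≤ y) (x : ℝ) :
    lambertW0 y = x ↔ -1 ≤ x ∧ x * Real.exp x = y := by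
  have h := exists_mul_exp_eq hy
  have h1 : lambertW0 y ∈ Ici (-1 : ℝ) := Function.invFunOn_mem h
  have h2 : lambertW0 y * Real.exp (lambertW0 y) = y := Function.invFunOn_eq h
  constructor
  · rintro rfl
    exact ⟨h1, h2⟩
  · rintro ⟨hx, hxy⟩
    exact strictMonoOn_mul_exp.injOn h1 hx (h2.trans hxy.symm)

/-- The change of variables `Φ(y) = p W₀(y/p)`. -/
def lambertPhi (p y : ℝ) : ℝ := p * lambertW0 (y / p)

/-- `Os-∫₀^∞ exp(i φ(x)) g(x) dx` exists and equals `L`: for every Schwartz function `χ` with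
`χ 0 = 1`, the integrals `∫₀^∞ exp(i φ(x)) g(x) χ(ε x) dx` tend to `L` as `ε → +0`. -/
def HasOscIntegral (φ : ℝ → ℝ) (g : ℝ → ℂ) (L : ℂ) : Prop :=
  ∀ χ : SchwartzMap ℝ ℂ, χ 0 = 1 →
    Tendsto (fun ε : ℝ => ∫ x in Ioi (0 : ℝ), Complex.exp (Complex.I * (φ x : ℂ)) * g x * χ (ε * x))
      (𝓝[>] 0) (𝓝 L)

/-- The generalized Fresnel integral `p⁻¹ exp(± i (π/2) (q/p)) Γ(q/p)`, where the real number
`s = ±1` is the sign. -/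
def genFresnel (s p q : ℝ) : ℂ :=
  (p : ℂ)⁻¹ * Complex.exp (s * Complex.I * (Real.pi / 2) * (q / p)) * (Real.Gamma (q / p) : ℂ)

/-- The two-sided coefficient: the half-line `x > 0` contributes the sign `s`, the half-line `x < 0`
contributes the factor `(-1)^k` and the sign `s * (-1)^m`. -/
def fresnelCoeff (s : ℝ) (m k : ℕ) : ℂ :=
  genFresnel s m (k + 1) + (-1) ^ k * genFresnel (s * (-1) ^ m) m (k + 1)

/-- The derivative of order `k` at `y = 0` of `a(p W₀(y/p)) W₀'(y/p)`. -/
def lambertDeriv (a : ℝ → ℂ) (p : ℝ) (k : ℕ) : ℂ :=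
  iteratedDeriv k (fun y : ℝ => a (p * lambertW0 (y / p)) * ((deriv lambertW0 (y / p) : ℝ) : ℂ)) 0

end

/-! The substitution `x = Φ(y)`, with `Φ` inverse to `x ↦ x e^{x/p}`, turns the phase `x^p e^x` into
the pure power `y^p` and the amplitude into `a(Φ(y)) Φ'(y)`. Once `supp a ⊆ (-p, ∞)`, this amplitude
extends by zero to a smooth compactly supported function, hence a Schwartz function `f`. It remains
to expand `∫₀^∞ e^{±iλy^p} f(y) dy`.

This integral is the boundary value at `z = ∓iλ` of the absolutely convergent integral `∫₀^∞ e^{-z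
y^p} f(y) dy`, `Re z > 0`. Watson's lemma is proved there uniformly up to the imaginary axis
(`SchwartzMap.isBigO_laplace`). A Taylor polynomial of `f` times a cutoff is subtracted, and the
remainder is integrated by parts: each step gains `1/z` and lowers the orders at `0` and `∞` by `p`.
Since `|e^{-z y^p}| ≤ 1`, the bounds do not see `Re z` (`SymbolBound.integral_bound`). The monomials
give Gamma integrals, continued analytically from `z > 0`. Letting `Re z → 0` gives
`SchwartzMap.isBigO_oscillatory`, from which the values of the oscillatory integrals follow by
scaling, and both expansions by the change of variables. -/

open MeasureTheory

/-! ### Symbol classes on the half-line. -/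

/-- `g` is `O(y ^ A)` on `(0, 1]` and `O(y ^ B)` on `[1, ∞)`. -/
def PowerBound (A B : ℝ) (g : ℝ → ℂ) : Prop :=
  ∃ C : ℝ, (∀ y, 0 < y → y ≤ 1 → ‖g y‖ ≤ C * y ^ A) ∧ ∀ y, 1 ≤ y → ‖g y‖ ≤ C * y ^ B

/-- Symbols on the half-line: `g` has `n` derivatives on `(0, ∞)`, and the `j`-th one is
`O(y ^ (A - j))` at `0` and `O(y ^ (B - j))` at infinity. -/
def SymbolBound : ℕ → ℝ → ℝ → (ℝ → ℂ) → Prop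
  | 0, A, B, g => ContinuousOn g (Ioi 0) ∧ PowerBound A B g
  | n + 1, A, B, g => PowerBound A B g ∧
      ∃ g' : ℝ → ℂ, (∀ y, 0 < y → HasDerivAt g (g' y) y) ∧ SymbolBound n (A - 1) (B - 1) g'

theorem PowerBound.add {A B : ℝ} {f g : ℝ → ℂ} (hf : PowerBound A B f) (hg : PowerBound A B g) :
    PowerBound A B (fun y => f y + g y) := by
  obtain ⟨C, h1, h2⟩ := hf
  obtain ⟨D, h3, h4⟩ := hg
  refine ⟨C + D, fun y hy hy1 => ?_, fun y hy => ?_⟩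
  · rw [add_mul]
    exact (norm_add_le _ _).trans (add_le_add (h1 y hy hy1) (h3 y hy hy1))
  · rw [add_mul]
    exact (norm_add_le _ _).trans (add_le_add (h2 y hy) (h4 y hy))

theorem PowerBound.mono {A B A' B' : ℝ} {g : ℝ → ℂ} (hg : PowerBound A B g) (hA : A' ≤ A)
    (hB : B ≤ B') : PowerBound A' B' g := by
  obtain ⟨C, h1, h2⟩ := hg
  have hC : 0 ≤ C := by simpa using (norm_nonneg _).trans (h1 1 one_pos le_rfl)
  refine ⟨C, fun y hy hy1 => (h1 y hy hy1).trans ?_, fun y hy => (h2 y hy).trans ?_⟩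
  · exact mul_le_mul_of_nonneg_left (Real.rpow_le_rpow_of_exponent_ge hy hy1 hA) hC
  · exact mul_le_mul_of_nonneg_left (Real.rpow_le_rpow_of_exponent_le hy hB) hC

theorem PowerBound.rpow_mul {A B : ℝ} {g : ℝ → ℂ} (hg : PowerBound A B g) (c : ℝ) :
    PowerBound (A + c) (B + c) (fun y => ((y ^ c : ℝ) : ℂ) * g y) := by
  obtain ⟨C, h1, h2⟩ := hg
  have key : ∀ y D : ℝ, 0 < y → ‖g y‖ ≤ C * y ^ D →
      ‖((y ^ c : ℝ) : ℂ) * g y‖ ≤ C * y ^ (D + c) := fun y D hy h => by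
    have hc : 0 < y ^ c := Real.rpow_pos_of_pos hy c
    rw [norm_mul, Complex.norm_real, Real.norm_of_nonneg hc.le, Real.rpow_add hy]
    calc y ^ c * ‖g y‖ ≤ y ^ c * (C * y ^ D) := mul_le_mul_of_nonneg_left h hc.le
      _ = C * (y ^ D * y ^ c) := by ring
  exact ⟨C, fun y hy hy1 => key y A hy (h1 y hy hy1),
    fun y hy => key y B (one_pos.trans_le hy) (h2 y hy)⟩

theorem PowerBound.const_mul {A B : ℝ} {g : ℝ → ℂ} (hg : PowerBound A B g) (c : ℂ) :
    PowerBound A B (fun y => c * g y) := by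
  obtain ⟨C, h1, h2⟩ := hg
  refine ⟨‖c‖ * C, fun y hy hy1 => ?_, fun y hy => ?_⟩
  · rw [norm_mul, mul_assoc]
    exact mul_le_mul_of_nonneg_left (h1 y hy hy1) (norm_nonneg _)
  · rw [norm_mul, mul_assoc]
    exact mul_le_mul_of_nonneg_left (h2 y hy) (norm_nonneg _)

theorem SymbolBound.powerBound {n : ℕ} {A B : ℝ} {g : ℝ → ℂ} (hg : SymbolBound n A B g) :
    PowerBound A B g := by
  cases n with
  | zero => exact hg.2
  | succ n => exact hg.1

theorem SymbolBound.continuousOn {n : ℕ} {A B : ℝ} {g : ℝ → ℂ} (hg : SymbolBound n A B g) :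
    ContinuousOn g (Ioi 0) := by
  cases n with
  | zero => exact hg.1
  | succ n =>
    obtain ⟨-, g', h, -⟩ := hg
    exact fun y hy => (h y hy).continuousAt.continuousWithinAt

theorem SymbolBound.of_succ {n : ℕ} {A B : ℝ} {g : ℝ → ℂ} (hg : SymbolBound (n + 1) A B g) :
    SymbolBound n A B g := by
  induction n generalizing A B g with
  | zero => exact ⟨hg.continuousOn, hg.powerBound⟩
  | succ n ih =>
    obtain ⟨h1, g', h2, h3⟩ := hg
    exact ⟨h1, g', h2, ih h3⟩

theorem SymbolBound.mono {n : ℕ} {A B A' B' : ℝ} {g : ℝ → ℂ} (hg : SymbolBound n A B g)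
    (hA : A' ≤ A) (hB : B ≤ B') : SymbolBound n A' B' g := by
  induction n generalizing A B A' B' g with
  | zero => exact ⟨hg.1, hg.2.mono hA hB⟩
  | succ n ih =>
    obtain ⟨h1, g', h2, h3⟩ := hg
    exact ⟨h1.mono hA hB, g', h2, ih h3 (by linarith) (by linarith)⟩

theorem SymbolBound.add {n : ℕ} {A B : ℝ} {f g : ℝ → ℂ} (hf : SymbolBound n A B f)
    (hg : SymbolBound n A B g) : SymbolBound n A B (fun y => f y + g y) := by
  induction n generalizing A B f g with
  | zero => exact ⟨hf.1.add hg.1, hf.2.add hg.2⟩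
  | succ n ih =>
    obtain ⟨h1, f', h2, h3⟩ := hf
    obtain ⟨k1, g', k2, k3⟩ := hg
    exact ⟨h1.add k1, _, fun y hy => (h2 y hy).add (k2 y hy), ih h3 k3⟩

theorem SymbolBound.const_mul {n : ℕ} {A B : ℝ} {g : ℝ → ℂ} (hg : SymbolBound n A B g) (c : ℂ) :
    SymbolBound n A B (fun y => c * g y) := by
  induction n generalizing A B g with
  | zero => exact ⟨continuousOn_const.mul hg.1, hg.2.const_mul c⟩
  | succ n ih =>
    obtain ⟨h1, g', h2, h3⟩ := hg
    exact ⟨h1.const_mul c, _, fun y hy => (h2 y hy).const_mul c, ih h3⟩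

/-- Both terms of the product rule lose exactly one order. The induction needs all `c` at once,
because `c - 1` appears. The factor `y^(1-p)` produced by integration by parts is the main use. -/
theorem SymbolBound.rpow_mul {n : ℕ} {A B : ℝ} {g : ℝ → ℂ} (hg : SymbolBound n A B g) (c : ℝ) :
    SymbolBound n (A + c) (B + c) (fun y => ((y ^ c : ℝ) : ℂ) * g y) := by
  induction n generalizing A B g c with
  | zero =>
    refine ⟨ContinuousOn.mul (fun y hy => ?_) hg.1, hg.2.rpow_mul c⟩
    exact (Complex.continuous_ofReal.continuousAt.comp
      (Real.continuousAt_rpow_const y c (Or.inl (ne_of_gt hy)))).continuousWithinAt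
  | succ n ih =>
    have hg0 := hg.of_succ
    obtain ⟨h1, g', h2, h3⟩ := hg
    refine ⟨h1.rpow_mul c, fun y => c * (((y ^ (c - 1) : ℝ) : ℂ) * g y) + ((y ^ c : ℝ) : ℂ) * g' y,
      fun y hy => ?_, ?_⟩
    · have := ((Real.hasDerivAt_rpow_const (p := c) (Or.inl hy.ne')).ofReal_comp).mul (h2 y hy)
      refine this.congr_deriv ?_
      push_cast
      ring
    · have e : ∀ D : ℝ, D + c - 1 = D + (c - 1) := fun D => by ring
      have e' : ∀ D : ℝ, D + c - 1 = D - 1 + c := fun D => by ring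
      refine SymbolBound.add ?_ ?_
      · rw [e, e]
        exact (ih hg0 (c - 1)).const_mul c
      · rw [e', e']
        exact ih h3 c

/-! ### Laplace integrals in `y^p` and integration by parts. -/

theorem integrableOn_of_powerBound {A B : ℝ} {g : ℝ → ℂ} (hc : ContinuousOn g (Ioi 0))
    (hg : PowerBound A B g) (hA : -1 < A) (hB : B < -1) : IntegrableOn g (Ioi 0) := by
  obtain ⟨C, h1, h2⟩ := hg
  rw [← Ioc_union_Ioi_eq_Ioi zero_le_one]
  refine IntegrableOn.union ?_ ?_
  · have : IntegrableOn (fun y : ℝ => C * y ^ A) (Ioc 0 1) := by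
      have := (intervalIntegral.intervalIntegrable_rpow' (a := 0) (b := 1) hA).const_mul C
      rwa [intervalIntegrable_iff_integrableOn_Ioc_of_le zero_le_one] at this
    refine Integrable.mono' this ((hc.mono Ioc_subset_Ioi_self).aestronglyMeasurable
      measurableSet_Ioc) ?_
    filter_upwards [ae_restrict_mem measurableSet_Ioc] with y hy using h1 y hy.1 hy.2
  · have : IntegrableOn (fun y : ℝ => C * y ^ B) (Ioi 1) :=
      (integrableOn_Ioi_rpow_of_lt hB one_pos).const_mul C
    refine Integrable.mono' this ((hc.mono (Ioi_subset_Ioi zero_le_one)).aestronglyMeasurable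
      measurableSet_Ioi) ?_
    filter_upwards [ae_restrict_mem measurableSet_Ioi] with y hy using h2 y (le_of_lt hy)

theorem norm_exp_neg_mul_rpow (z : ℂ) (p y : ℝ) :
    ‖Complex.exp (-z * ((y ^ p : ℝ) : ℂ))‖ = Real.exp (-z.re * y ^ p) := by
  rw [Complex.norm_exp]
  simp

theorem continuousOn_exp_neg_mul_rpow (z : ℂ) (p : ℝ) :
    ContinuousOn (fun y : ℝ => Complex.exp (-z * ((y ^ p : ℝ) : ℂ))) (Ioi 0) := by
  refine Complex.continuous_exp.comp_continuousOn (continuousOn_const.mul ?_)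
  exact Complex.continuous_ofReal.comp_continuousOn
    fun y hy => (Real.continuousAt_rpow_const y p (Or.inl (ne_of_gt hy))).continuousWithinAt

theorem integrableOn_exp_mul_of_powerBound {A B p : ℝ} {g : ℝ → ℂ} {z : ℂ}
    (hc : ContinuousOn g (Ioi 0)) (hg : PowerBound A B g) (hA : -1 < A) (hp : 0 < p)
    (hz : 0 < z.re) :
    IntegrableOn (fun y : ℝ => Complex.exp (-z * ((y ^ p : ℝ) : ℂ)) * g y) (Ioi 0) := by
  -- The exponential absorbs any growth at infinity. Raising `B` to `max B 0` makes the second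
  -- majorant integrable near `0` as well, so one sum dominates on the whole half-line.
  obtain ⟨C, h1, h2⟩ := hg.mono le_rfl (le_max_left B 0)
  have hC : 0 ≤ C := by simpa using (norm_nonneg _).trans (h1 1 one_pos le_rfl)
  have i1 := (integrableOn_rpow_mul_exp_neg_mul_rpow hA hp hz).const_mul C
  have i2 := (integrableOn_rpow_mul_exp_neg_mul_rpow (s := max B 0)
    (by linarith [le_max_right B 0]) hp hz).const_mul C
  refine Integrable.mono' (i1.add i2) (((continuousOn_exp_neg_mul_rpow z p).mul
    hc).aestronglyMeasurable measurableSet_Ioi) ?_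
  filter_upwards [ae_restrict_mem measurableSet_Ioi] with y hy
  have hy : 0 < y := hy
  have e := Real.exp_pos (-z.re * y ^ p)
  have p1 := Real.rpow_pos_of_pos hy A
  have p2 := Real.rpow_pos_of_pos hy (max B 0)
  rw [norm_mul, norm_exp_neg_mul_rpow]
  have hgy : ‖g y‖ ≤ C * y ^ A + C * y ^ max B 0 := by
    rcases le_total y 1 with h | h
    · exact (h1 y hy h).trans (le_add_of_nonneg_right (by positivity))
    · exact (h2 y h).trans (le_add_of_nonneg_left (by positivity))
  calc _ ≤ Real.exp (-z.re * y ^ p) * (C * y ^ A + C * y ^ max B 0) :=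
        mul_le_mul_of_nonneg_left hgy e.le
    _ = _ := by simp only [Pi.add_apply]; ring

theorem tendsto_exp_mul_nhdsGT_zero {A B p : ℝ} {g : ℝ → ℂ} {z : ℂ} (hg : PowerBound A B g)
    (hA : 0 < A) (hz : 0 < z.re) :
    Tendsto (fun y : ℝ => Complex.exp (-z * ((y ^ p : ℝ) : ℂ)) * g y) (𝓝[>] 0) (𝓝 0) := by
  obtain ⟨C, h1, -⟩ := hg
  have hlim : Tendsto (fun y : ℝ => C * y ^ A) (𝓝[>] 0) (𝓝 0) := by
    have : ContinuousAt (fun y : ℝ => C * y ^ A) 0 :=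
      continuousAt_const.mul (Real.continuousAt_rpow_const 0 A (Or.inr hA.le))
    have := this.tendsto
    rw [Real.zero_rpow hA.ne', mul_zero] at this
    exact this.mono_left nhdsWithin_le_nhds
  refine squeeze_zero_norm' ?_ hlim
  filter_upwards [Ioc_mem_nhdsGT zero_lt_one] with y hy
  rw [norm_mul, norm_exp_neg_mul_rpow]
  have : Real.exp (-z.re * y ^ p) ≤ 1 := by
    rw [Real.exp_le_one_iff]
    nlinarith [Real.rpow_nonneg hy.1.le p]
  exact (mul_le_of_le_one_left (norm_nonneg _) this).trans (h1 y hy.1 hy.2)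

theorem tendsto_exp_mul_atTop {A B p : ℝ} {g : ℝ → ℂ} {z : ℂ} (hg : PowerBound A B g)
    (hp : 0 < p) (hz : 0 < z.re) :
    Tendsto (fun y : ℝ => Complex.exp (-z * ((y ^ p : ℝ) : ℂ)) * g y) atTop (𝓝 0) := by
  obtain ⟨C, -, h2⟩ := hg
  have hlim : Tendsto (fun y : ℝ => C * ((y ^ p) ^ (B / p) * Real.exp (-z.re * y ^ p)))
      atTop (𝓝 0) := by
    simpa using ((tendsto_rpow_mul_exp_neg_mul_atTop_nhds_zero (B / p) z.re hz).comp
      (tendsto_rpow_atTop hp)).const_mul C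
  refine squeeze_zero_norm' ?_ hlim
  filter_upwards [eventually_ge_atTop 1] with y hy
  rw [norm_mul, norm_exp_neg_mul_rpow, ← Real.rpow_mul (by linarith), mul_div_cancel₀ _ hp.ne']
  calc _ ≤ Real.exp (-z.re * y ^ p) * (C * y ^ B) :=
        mul_le_mul_of_nonneg_left (h2 y hy) (Real.exp_pos _).le
    _ = _ := by ring

/-- One integration by parts against `exp (-z y ^ p)`. -/
theorem SymbolBound.exists_integral_eq {n : ℕ} {A B p : ℝ} {g : ℝ → ℂ}
    (hg : SymbolBound (n + 1) A B g) (hp : 0 < p) (hA : -1 < A - p) :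
    ∃ h : ℝ → ℂ, SymbolBound n (A - p) (B - p) h ∧ ∀ z : ℂ, 0 < z.re →
      z * ∫ y in Ioi (0 : ℝ), Complex.exp (-z * ((y ^ p : ℝ) : ℂ)) * g y =
        ∫ y in Ioi (0 : ℝ), Complex.exp (-z * ((y ^ p : ℝ) : ℂ)) * h y := by
  -- Since `z e^{-z y^p} = -p⁻¹ y^(1-p) (e^{-z y^p})'`, the new amplitude is the derivative of `p⁻¹
  -- y^(1-p) g`.
  have hG := (hg.rpow_mul (1 - p)).const_mul (p : ℂ)⁻¹
  obtain ⟨hGb, h, hd, hh⟩ := hG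
  have eA : ∀ D : ℝ, D + (1 - p) - 1 = D - p := fun D => by ring
  rw [eA, eA] at hh
  refine ⟨h, hh, fun z hz => ?_⟩
  have hcong : ∀ y ∈ Ioi (0 : ℝ), (-z * ((p * y ^ (p - 1) : ℝ) : ℂ) *
      Complex.exp (-z * ((y ^ p : ℝ) : ℂ))) * ((p : ℂ)⁻¹ * (((y ^ (1 - p) : ℝ) : ℂ) * g y)) =
      -z * (Complex.exp (-z * ((y ^ p : ℝ) : ℂ)) * g y) := fun y hy => by
    have h1 : y ^ (p - 1) * y ^ (1 - p) = 1 := by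
      rw [← Real.rpow_add hy]; simp
    have h2 : ((y ^ (p - 1) : ℝ) : ℂ) * ((y ^ (1 - p) : ℝ) : ℂ) = 1 := by
      rw [← Complex.ofReal_mul, h1, Complex.ofReal_one]
    have h3 : (p : ℂ) * (p : ℂ)⁻¹ = 1 := mul_inv_cancel₀ (by exact_mod_cast hp.ne')
    rw [Complex.ofReal_mul]
    linear_combination (-z * Complex.exp (-z * ((y ^ p : ℝ) : ℂ)) * g y) *
      ((((y ^ (p - 1) : ℝ) : ℂ) * ((y ^ (1 - p) : ℝ) : ℂ)) * h3 + h2)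
  have hu : ∀ y ∈ Ioi (0 : ℝ), HasDerivAt (fun y : ℝ => Complex.exp (-z * ((y ^ p : ℝ) : ℂ)))
      (-z * ((p * y ^ (p - 1) : ℝ) : ℂ) * Complex.exp (-z * ((y ^ p : ℝ) : ℂ))) y := fun y hy => by
    have := (((Real.hasDerivAt_rpow_const (p := p)
      (Or.inl (ne_of_gt hy))).ofReal_comp).const_mul (-z)).cexp
    refine this.congr_deriv ?_
    ring
  have hgi := integrableOn_exp_mul_of_powerBound hg.continuousOn hg.powerBound (by linarith) hp hz
  have key := integral_Ioi_mul_deriv_eq_deriv_mul (a := (0 : ℝ)) (a' := (0 : ℂ)) (b' := 0)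
    (u := fun y : ℝ => Complex.exp (-z * ((y ^ p : ℝ) : ℂ)))
    (v := fun y : ℝ => (p : ℂ)⁻¹ * (((y ^ (1 - p) : ℝ) : ℂ) * g y)) hu
    (fun y hy => hd y hy)
    (integrableOn_exp_mul_of_powerBound hh.continuousOn hh.powerBound hA hp hz)
    ((integrableOn_congr_fun hcong measurableSet_Ioi).2 (hgi.const_mul _))
    -- The boundary term at `0` has order `A + 1 - p > 0`, which is exactly `hA`.
    (tendsto_exp_mul_nhdsGT_zero hGb (by linarith) hz)
    (tendsto_exp_mul_atTop hGb hp hz)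
  rw [key, setIntegral_congr_fun measurableSet_Ioi hcong, integral_const_mul]
  ring

/-- After `n` integrations by parts the amplitude is absolutely integrable and the exponential has
modulus at most `1`. Hence `C` is independent of `z`, which is what later allows `Re z → 0`. -/
theorem SymbolBound.integral_bound {n : ℕ} {A B p : ℝ} {g : ℝ → ℂ} (hg : SymbolBound n A B g)
    (hp : 0 < p) (hA : -1 < A - n * p) (hB : B - n * p < -1) :
    ∃ C : ℝ, ∀ z : ℂ, 0 < z.re →
      ‖z‖ ^ n * ‖∫ y in Ioi (0 : ℝ), Complex.exp (-z * ((y ^ p : ℝ) : ℂ)) * g y‖ ≤ C := by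
  induction n generalizing A B g with
  | zero =>
    simp only [CharP.cast_eq_zero, zero_mul, sub_zero] at hA hB
    have hi := integrableOn_of_powerBound hg.1 hg.2 hA hB
    refine ⟨∫ y in Ioi (0 : ℝ), ‖g y‖, fun z hz => ?_⟩
    rw [pow_zero, one_mul]
    refine norm_integral_le_of_norm_le hi.norm ?_
    filter_upwards [ae_restrict_mem measurableSet_Ioi] with y hy
    rw [norm_mul, norm_exp_neg_mul_rpow]
    refine mul_le_of_le_one_left (norm_nonneg _) (Real.exp_le_one_iff.2 ?_)
    nlinarith [Real.rpow_nonneg (le_of_lt hy) p]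
  | succ n ih =>
    push_cast at hA hB
    obtain ⟨h, hh, heq⟩ := hg.exists_integral_eq hp (by nlinarith [mul_nonneg n.cast_nonneg hp.le])
    obtain ⟨C, hC⟩ := ih hh (by linarith) (by linarith)
    refine ⟨C, fun z hz => ?_⟩
    rw [pow_succ, mul_assoc, ← norm_mul, heq z hz]
    exact hC z hz

theorem norm_le_mul_pow_succ_of_deriv {h : ℝ → ℂ} (hd : Differentiable ℝ h) (h0 : h 0 = 0) {C : ℝ}
    {k : ℕ} (hC : ∀ y, 0 ≤ y → y ≤ 1 → ‖deriv h y‖ ≤ C * y ^ k) {y : ℝ} (hy : 0 ≤ y) (hy1 : y ≤ 1) :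
    ‖h y‖ ≤ C * y ^ (k + 1) := by
  have hC0 : 0 ≤ C := by simpa using (norm_nonneg _).trans (hC 1 zero_le_one le_rfl)
  have := norm_image_sub_le_of_norm_deriv_le_segment' (f := h) (f' := deriv h) (a := 0) (b := y)
    (C := C * y ^ k) (fun x _ => (hd x).hasDerivAt.hasDerivWithinAt)
    (fun x hx => (hC x hx.1 (hx.2.le.trans hy1)).trans
      (mul_le_mul_of_nonneg_left (pow_le_pow_left₀ hx.1 hx.2.le k) hC0)) y ⟨hy, le_rfl⟩
  rw [h0, sub_zero, sub_zero] at this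
  rwa [pow_succ, ← mul_assoc]

/-! ### Schwartz functions as symbols, and cutoffs. -/

namespace SchwartzMap

theorem exists_norm_le_mul_pow_of_iteratedDeriv_eq_zero (M : ℕ) (h : SchwartzMap ℝ ℂ)
    (h0 : ∀ j < M, iteratedDeriv j h 0 = 0) :
    ∃ C : ℝ, ∀ y, 0 ≤ y → y ≤ 1 → ‖h y‖ ≤ C * y ^ M := by
  induction M generalizing h with
  | zero =>
    obtain ⟨C, -, hC⟩ := h.decay 0 0
    exact ⟨C, fun y _ _ => by simpa using hC y⟩
  | succ M ih =>
    obtain ⟨C, hC⟩ := ih (derivCLM ℂ ℂ h) fun j hj => by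
      have := h0 (j + 1) (by omega)
      rwa [iteratedDeriv_succ'] at this
    exact ⟨C, fun y => norm_le_mul_pow_succ_of_deriv h.differentiable
      (by simpa using h0 0 M.succ_pos) hC⟩

theorem exists_norm_le_mul_rpow (B : ℝ) (h : SchwartzMap ℝ ℂ) :
    ∃ C : ℝ, ∀ y, 1 ≤ y → ‖h y‖ ≤ C * y ^ B := by
  obtain ⟨C, hC0, hC⟩ := h.decay ⌈-B⌉₊ 0
  refine ⟨C, fun y hy => ?_⟩
  have hy0 : 0 < y := one_pos.trans_le hy
  have h1 := hC y
  rw [norm_iteratedFDeriv_zero, Real.norm_of_nonneg hy0.le, ← Real.rpow_natCast] at h1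
  have h2 : (1 : ℝ) ≤ y ^ (⌈-B⌉₊ : ℝ) * y ^ B := by
    rw [← Real.rpow_add hy0]
    exact Real.one_le_rpow hy (by linarith [Nat.le_ceil (-B)])
  have h3 : 0 < y ^ B := Real.rpow_pos_of_pos hy0 B
  calc ‖h y‖ ≤ (y ^ (⌈-B⌉₊ : ℝ) * y ^ B) * ‖h y‖ := le_mul_of_one_le_left (norm_nonneg _) h2
    _ = (y ^ (⌈-B⌉₊ : ℝ) * ‖h y‖) * y ^ B := by ring
    _ ≤ C * y ^ B := mul_le_mul_of_nonneg_right h1 h3.le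

theorem powerBound (B : ℝ) {M : ℕ} (h : SchwartzMap ℝ ℂ)
    (h0 : ∀ j < M, iteratedDeriv j h 0 = 0) : PowerBound M B h := by
  obtain ⟨C, hC⟩ := h.exists_norm_le_mul_pow_of_iteratedDeriv_eq_zero M h0
  obtain ⟨D, hD⟩ := h.exists_norm_le_mul_rpow B
  refine ⟨max C D, fun y hy hy1 => ?_, fun y hy => ?_⟩
  · rw [Real.rpow_natCast]
    exact (hC y hy.le hy1).trans (mul_le_mul_of_nonneg_right (le_max_left _ _) (by positivity))
  · exact (hD y hy).trans (mul_le_mul_of_nonneg_right (le_max_right _ _) (by positivity))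

theorem symbolBound (n : ℕ) (B : ℝ) {M : ℕ} (h : SchwartzMap ℝ ℂ)
    (h0 : ∀ j < M, iteratedDeriv j h 0 = 0) : SymbolBound n M B h := by
  induction n generalizing M B h with
  | zero => exact ⟨h.continuous.continuousOn, h.powerBound B h0⟩
  | succ n ih =>
    refine ⟨h.powerBound B h0, derivCLM ℂ ℂ h, fun y _ => (h.differentiable y).hasDerivAt, ?_⟩
    -- For `M = 0` nothing is known about the derivative at `0`, but boundedness is already more
    -- than the required `O(y^(-1))`.
    cases M with
    | zero => exact (ih (B - 1) (M := 0) (derivCLM ℂ ℂ h) (by simp)).mono (by simp) le_rfl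
    | succ M =>
      rw [Nat.cast_succ, add_sub_cancel_right]
      refine ih (B - 1) (derivCLM ℂ ℂ h) fun j hj => ?_
      have := h0 (j + 1) (by omega)
      rwa [iteratedDeriv_succ'] at this

/-- Multiplication of a Schwartz function by a monomial. -/
noncomputable def powMul (k : ℕ) (f : SchwartzMap ℝ ℂ) : SchwartzMap ℝ ℂ :=
  smulLeftCLM ℂ (fun x : ℝ => x ^ k) f

theorem powMul_apply (k : ℕ) (f : SchwartzMap ℝ ℂ) (x : ℝ) :
    powMul k f x = (x : ℂ) ^ k * f x := by
  rw [powMul, smulLeftCLM_apply (by fun_prop)]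
  simp

theorem exists_eventuallyEq_one : ∃ ψ : SchwartzMap ℝ ℂ, ψ =ᶠ[𝓝 0] fun _ => 1 := by
  let b : ContDiffBump (0 : ℝ) := ⟨1, 2, one_pos, one_lt_two⟩
  have hs : HasCompactSupport (fun x => (b x : ℂ)) :=
    b.hasCompactSupport.comp_left (g := Complex.ofReal) Complex.ofReal_zero
  refine ⟨hs.toSchwartzMap (Complex.ofRealCLM.contDiff.comp b.contDiff), ?_⟩
  filter_upwards [b.eventuallyEq_one] with x hx
  change (b x : ℂ) = 1
  rw [hx]
  simp

/-- A smooth function that is `1` near `0` and Schwartz: its complement is a symbol of order `0`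
vanishing to infinite order at `0`. -/
theorem symbolBound_one_sub (n M : ℕ) {ψ : SchwartzMap ℝ ℂ} (hψ : ψ =ᶠ[𝓝 0] fun _ => 1) :
    SymbolBound n M 0 (fun y => 1 - ψ y) := by
  have hvan : ∀ M' : ℕ, ∀ j < M', iteratedDeriv j (-derivCLM ℂ ℂ ψ) 0 = 0 := fun M' j _ => by
    have h1 : (-derivCLM ℂ ℂ ψ : SchwartzMap ℝ ℂ) =ᶠ[𝓝 0] fun _ => (0 : ℂ) := by
      filter_upwards [hψ.deriv] with x hx
      simp [hx]
    rw [h1.iteratedDeriv_eq j]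
    simp
  have hd : ∀ y, HasDerivAt (fun y => 1 - ψ y) ((-derivCLM ℂ ℂ ψ) y) y := fun y => by
    simpa using (ψ.differentiable y).hasDerivAt.const_sub 1
  have hb : PowerBound M 0 (fun y => 1 - ψ y) := by
    obtain ⟨C, hC⟩ := (-derivCLM ℂ ℂ ψ).exists_norm_le_mul_pow_of_iteratedDeriv_eq_zero M (hvan M)
    obtain ⟨D, -, hD⟩ := ψ.decay 0 0
    have hC0 : 0 ≤ C := by simpa using (norm_nonneg _).trans (hC 1 zero_le_one le_rfl)
    refine ⟨max C (1 + D), fun y hy hy1 => ?_, fun y hy => ?_⟩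
    · rw [Real.rpow_natCast]
      have h1 : ‖1 - ψ y‖ ≤ C * y ^ (M + 1) := by
        refine norm_le_mul_pow_succ_of_deriv (h := fun y => 1 - ψ y)
          (fun x => (hd x).differentiableAt) ?_ (fun x hx hx1 => ?_) hy.le hy1
        · simp [hψ.eq_of_nhds]
        · rw [(hd x).deriv]
          exact hC x hx hx1
      calc ‖1 - ψ y‖ ≤ C * y ^ (M + 1) := h1
        _ ≤ C * y ^ M := mul_le_mul_of_nonneg_left
            (pow_le_pow_of_le_one hy.le hy1 (Nat.le_succ M)) hC0
        _ ≤ _ := mul_le_mul_of_nonneg_right (le_max_left _ _) (by positivity)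
    · rw [Real.rpow_zero, mul_one]
      have := hD y
      simp only [pow_zero, one_mul, norm_iteratedFDeriv_zero] at this
      calc ‖1 - ψ y‖ ≤ ‖(1 : ℂ)‖ + ‖ψ y‖ := norm_sub_le _ _
        _ ≤ 1 + D := by rw [norm_one]; linarith
        _ ≤ _ := le_max_right _ _
  cases n with
  | zero => exact ⟨(continuous_const.sub ψ.continuous).continuousOn, hb⟩
  | succ n =>
    refine ⟨hb, (-derivCLM ℂ ℂ ψ), fun y _ => hd y, ?_⟩
    -- `ψ'` vanishes near `0`, so it has order `M` there, although only `M - 1` is needed.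
    exact ((-derivCLM ℂ ℂ ψ).symbolBound n (0 - 1) (hvan M)).mono (by linarith) le_rfl

end SchwartzMap

/-! ### Watson's lemma in the right half-plane. -/

/-- Infinity in the open right half-plane. -/
noncomputable def rightHalfPlaneAtInfty : Filter ℂ := Bornology.cobounded ℂ ⊓ 𝓟 {z | 0 < z.re}

theorem eventually_rightHalfPlaneAtInfty (R : ℝ) :
    ∀ᶠ z in rightHalfPlaneAtInfty, R ≤ ‖z‖ ∧ 0 < z.re :=
  ((tendsto_norm_cobounded_atTop.eventually_ge_atTop R).filter_mono inf_le_left).and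
    (mem_inf_of_right (mem_principal_self _))

theorem isBigO_norm_rpow {α β : ℝ} (h : α ≤ β) :
    (fun z : ℂ => ‖z‖ ^ (-β)) =O[rightHalfPlaneAtInfty] fun z => ‖z‖ ^ (-α) := by
  refine IsBigO.of_bound 1 ?_
  filter_upwards [eventually_rightHalfPlaneAtInfty 1] with z hz
  rw [one_mul, Real.norm_of_nonneg (by positivity), Real.norm_of_nonneg (by positivity)]
  exact Real.rpow_le_rpow_of_exponent_le hz.1 (by linarith)

theorem SymbolBound.isBigO {n : ℕ} {A B p β : ℝ} {g : ℝ → ℂ} (hg : SymbolBound n A B g)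
    (hp : 0 < p) (hA : -1 < A - n * p) (hB : B - n * p < -1) (hβ : β ≤ n) :
    (fun z : ℂ => ∫ y in Ioi (0 : ℝ), Complex.exp (-z * ((y ^ p : ℝ) : ℂ)) * g y)
      =O[rightHalfPlaneAtInfty] fun z => ‖z‖ ^ (-β) := by
  obtain ⟨C, hC⟩ := hg.integral_bound hp hA hB
  refine IsBigO.trans (IsBigO.of_bound C ?_) (isBigO_norm_rpow hβ)
  filter_upwards [eventually_rightHalfPlaneAtInfty 1] with z hz
  have hz0 : 0 < ‖z‖ := one_pos.trans_le hz.1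
  rw [Real.norm_of_nonneg (by positivity), Real.rpow_neg hz0.le, Real.rpow_natCast,
    ← div_eq_mul_inv, le_div_iff₀ (by positivity), mul_comm]
  exact hC z hz.2

/-- The Laplace transform of `y ^ k` in the variable `y ^ p`. -/
noncomputable def laplaceModel (p : ℝ) (k : ℕ) (z : ℂ) : ℂ :=
  (p : ℂ)⁻¹ * (Real.Gamma ((k + 1) / p) : ℂ) * z ^ (((-((k + 1) / p) : ℝ)) : ℂ)

theorem powerBound_rpow (k : ℝ) : PowerBound k k (fun y => ((y ^ k : ℝ) : ℂ)) := by
  refine ⟨1, fun y hy _ => ?_, fun y hy => ?_⟩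
  · rw [one_mul, Complex.norm_real, Real.norm_of_nonneg (by positivity)]
  · rw [one_mul, Complex.norm_real, Real.norm_of_nonneg (Real.rpow_nonneg (by linarith) k)]

theorem continuousOn_ofReal_rpow (k : ℝ) :
    ContinuousOn (fun y : ℝ => ((y ^ k : ℝ) : ℂ)) (Ioi 0) := fun y hy =>
  (Complex.continuous_ofReal.continuousAt.comp
    (Real.continuousAt_rpow_const y k (Or.inl (ne_of_gt hy)))).continuousWithinAt

theorem differentiableAt_integral_exp_mul_rpow {p q : ℝ} (hp : 0 < p) (hq : -1 < q) {z : ℂ}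
    (hz : 0 < z.re) :
    DifferentiableAt ℂ (fun z : ℂ =>
      ∫ y in Ioi (0 : ℝ), Complex.exp (-z * ((y ^ p : ℝ) : ℂ)) * ((y ^ q : ℝ) : ℂ)) z := by
  have hmeas : ∀ (w : ℂ) (r : ℝ), AEStronglyMeasurable
      (fun y : ℝ => Complex.exp (-w * ((y ^ p : ℝ) : ℂ)) * ((y ^ r : ℝ) : ℂ))
      (volume.restrict (Ioi 0)) := fun w r =>
    ((continuousOn_exp_neg_mul_rpow w p).mul (continuousOn_ofReal_rpow r)).aestronglyMeasurable
      measurableSet_Ioi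
  -- Staying at `Re w > Re z / 2` gives a majorant of the `w`-derivative that is uniform near `z`.
  have hU : {w : ℂ | z.re / 2 < w.re} ∈ 𝓝 z :=
    (isOpen_lt continuous_const Complex.continuous_re).mem_nhds (by simp; linarith)
  refine (hasDerivAt_integral_of_dominated_loc_of_deriv_le (μ := volume.restrict (Ioi 0))
    (F' := fun w y => -(Complex.exp (-w * ((y ^ p : ℝ) : ℂ)) * ((y ^ (q + p) : ℝ) : ℂ)))
    (bound := fun y => y ^ (q + p) * Real.exp (-(z.re / 2) * y ^ p)) hU
    (Eventually.of_forall fun w => hmeas w q)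
    (integrableOn_exp_mul_of_powerBound (continuousOn_ofReal_rpow q) (powerBound_rpow q) hq hp hz)
    (hmeas z (q + p)).neg ?_
    (integrableOn_rpow_mul_exp_neg_mul_rpow (by linarith) hp (by linarith)) ?_).2.differentiableAt
  · filter_upwards [ae_restrict_mem measurableSet_Ioi] with y hy w hw
    have hw : z.re / 2 < w.re := hw
    rw [norm_neg, norm_mul, norm_exp_neg_mul_rpow, Complex.norm_real,
      Real.norm_of_nonneg (Real.rpow_nonneg (le_of_lt hy) _), mul_comm]
    have : 0 ≤ y ^ p := Real.rpow_nonneg (le_of_lt hy) _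
    gcongr
    · exact Real.rpow_nonneg (le_of_lt hy) _
  · filter_upwards [ae_restrict_mem measurableSet_Ioi] with y hy w _
    have h := (((hasDerivAt_id w).neg.mul_const ((y ^ p : ℝ) : ℂ)).cexp).mul_const
      ((y ^ q : ℝ) : ℂ)
    refine h.congr_deriv ?_
    rw [Real.rpow_add hy]
    push_cast
    simp only [id, Pi.neg_apply]
    ring

/-- Both sides are analytic for `Re z > 0` and agree for `z > 0` by the Gamma integral; the identity
theorem does the rest. -/
theorem integral_exp_mul_rpow_eq_laplaceModel {p : ℝ} (hp : 0 < p) (k : ℕ) {z : ℂ}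
    (hz : 0 < z.re) :
    ∫ y in Ioi (0 : ℝ), Complex.exp (-z * ((y ^ p : ℝ) : ℂ)) * ((y ^ (k : ℝ) : ℝ) : ℂ) =
      laplaceModel p k z := by
  have hq : (-1 : ℝ) < k := by linarith [k.cast_nonneg (α := ℝ)]
  have hopen : IsOpen {w : ℂ | 0 < w.re} := isOpen_lt continuous_const Complex.continuous_re
  have hF : AnalyticOnNhd ℂ (fun z : ℂ => ∫ y in Ioi (0 : ℝ),
      Complex.exp (-z * ((y ^ p : ℝ) : ℂ)) * ((y ^ (k : ℝ) : ℝ) : ℂ)) {w : ℂ | 0 < w.re} :=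
    DifferentiableOn.analyticOnNhd (fun w hw =>
      (differentiableAt_integral_exp_mul_rpow hp hq hw).differentiableWithinAt) hopen
  have hG : AnalyticOnNhd ℂ (laplaceModel p k) {w : ℂ | 0 < w.re} :=
    DifferentiableOn.analyticOnNhd (fun w hw => ((differentiableAt_id.cpow_const
      (Or.inl hw)).const_mul _).differentiableWithinAt) hopen
  refine hF.eqOn_of_preconnected_of_frequently_eq hG
    (convex_halfSpace_re_gt 0).isPreconnected (z₀ := 1) (by simp) ?_ hz
  have hreal : ∀ r : ℝ, 0 < r → (∫ y in Ioi (0 : ℝ),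
      Complex.exp (-(r : ℂ) * ((y ^ p : ℝ) : ℂ)) * ((y ^ (k : ℝ) : ℝ) : ℂ)) =
      laplaceModel p k r := fun r hr => by
    have h := integral_rpow_mul_exp_neg_mul_rpow hp hq hr
    have h2 := congrArg Complex.ofReal h
    rw [← integral_complex_ofReal] at h2
    rw [laplaceModel, ← Complex.ofReal_cpow hr.le]
    convert! h2 using 1
    · refine setIntegral_congr_fun measurableSet_Ioi fun y _ => ?_
      push_cast
      ring
    · rw [neg_div]
      push_cast
      ring
  have ht : Tendsto (fun r : ℝ => (r : ℂ)) (𝓝[≠] 1) (𝓝[≠] 1) := by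
    refine tendsto_nhdsWithin_iff.2 ⟨?_, ?_⟩
    · exact (Complex.continuous_ofReal.tendsto' 1 1 Complex.ofReal_one).mono_left nhdsWithin_le_nhds
    · filter_upwards [self_mem_nhdsWithin] with r hr
      exact fun h => hr (Complex.ofReal_eq_one.1 h)
  refine ht.frequently (Eventually.frequently ?_)
  filter_upwards [nhdsWithin_le_nhds (lt_mem_nhds one_pos)] with r hr using hreal r hr

theorem iteratedDeriv_ofReal_pow_zero (j k : ℕ) :
    iteratedDeriv j (fun x : ℝ => (x : ℂ) ^ k) 0 = if j = k then (k.factorial : ℂ) else 0 := by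
  have h : (fun x : ℝ => (x : ℂ) ^ k) = fun x : ℝ => (x ^ k) • (1 : ℂ) := by
    funext x; simp
  rw [h, iteratedDeriv_smul_const (by fun_prop), iteratedDeriv_fun_pow_zero]
  split_ifs <;> simp

/-- The error is minus the Laplace integral of `(1 - ψ) y^k`, which is flat at `0` and of order `k`
at infinity. It can be integrated by parts as often as desired. -/
theorem isBigO_laplace_cutoff_monomial {p : ℝ} (hp : 0 < p) (k : ℕ) (β : ℝ)
    {ψ : SchwartzMap ℝ ℂ} (hψ : ψ =ᶠ[𝓝 0] fun _ => 1) :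
    (fun z : ℂ => (∫ y in Ioi (0 : ℝ), Complex.exp (-z * ((y ^ p : ℝ) : ℂ)) * ψ.powMul k y) -
      laplaceModel p k z) =O[rightHalfPlaneAtInfty] fun z => ‖z‖ ^ (-β) := by
  -- `n ≥ β` gives the decay, `n p ≥ k + 2` the integrability at infinity after `n` steps, and `M ≥
  -- n p` the integrability at `0`.
  obtain ⟨n, hn⟩ := exists_nat_ge (max β ((k + 2) / p))
  obtain ⟨M, hM⟩ := exists_nat_ge (n * p)
  have hnp : k + 2 ≤ n * p := by
    have := (le_max_right _ _).trans hn
    rwa [div_le_iff₀ hp] at this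
  have hs := (SchwartzMap.symbolBound_one_sub n M hψ).rpow_mul k
  have hO := hs.isBigO hp (by linarith [k.cast_nonneg (α := ℝ)]) (by linarith)
    ((le_max_left _ _).trans hn)
  refine (hO.const_mul_left (-1)).congr' ?_ EventuallyEq.rfl
  filter_upwards [eventually_rightHalfPlaneAtInfty 1] with z hz
  rw [← integral_exp_mul_rpow_eq_laplaceModel hp k hz.2, ← integral_const_mul, ← integral_sub]
  · refine setIntegral_congr_fun measurableSet_Ioi fun y hy => ?_
    simp only [SchwartzMap.powMul_apply, Real.rpow_natCast, Complex.ofReal_pow]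
    ring
  · exact integrableOn_exp_mul_of_powerBound (A := 0) (B := 0) (ψ.powMul k).continuous.continuousOn
      (by exact_mod_cast (ψ.powMul k).powerBound (M := 0) 0 (by simp)) (by norm_num) hp hz.2
  · exact integrableOn_exp_mul_of_powerBound (continuousOn_ofReal_rpow k) (powerBound_rpow k)
      (by linarith [k.cast_nonneg (α := ℝ)]) hp hz.2

theorem isBigO_laplaceModel {p : ℝ} (hp : 0 < p) {k N : ℕ} (h : N ≤ k) :
    laplaceModel p k =O[rightHalfPlaneAtInfty] fun z => ‖z‖ ^ (-((N + 1 : ℝ) / p)) := by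
  have h1 : laplaceModel p k =O[rightHalfPlaneAtInfty] fun z => ‖z‖ ^ (-((k + 1 : ℝ) / p)) := by
    refine IsBigO.const_mul_left (IsBigO.of_bound 1 (Eventually.of_forall fun z => ?_)) _
    rw [one_mul, Complex.norm_cpow_real, Real.norm_of_nonneg (by positivity)]
  refine h1.trans (isBigO_norm_rpow ?_)
  gcongr

/-- Watson's lemma in the variable `y ^ p`, uniformly in the open right half-plane. -/
theorem SchwartzMap.isBigO_laplace (f : SchwartzMap ℝ ℂ) {p : ℝ} (hp : 0 < p) (N : ℕ) :
    (fun z : ℂ => (∫ y in Ioi (0 : ℝ), Complex.exp (-z * ((y ^ p : ℝ) : ℂ)) * f y) -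
      ∑ k ∈ Finset.range N, iteratedDeriv k f 0 / (k.factorial : ℂ) * laplaceModel p k z)
      =O[rightHalfPlaneAtInfty] fun z => ‖z‖ ^ (-((N + 1 : ℝ) / p)) := by
  obtain ⟨ψ, hψ⟩ := SchwartzMap.exists_eventuallyEq_one
  obtain ⟨n, hn⟩ := exists_nat_ge ((N + 1 : ℝ) / p)
  obtain ⟨L, hL⟩ := exists_nat_ge (n * p)
  -- The Taylor polynomial must reach order `n p` for `n` integrations by parts to be legitimate;
  -- its terms with `N ≤ k < M` then go into the error.
  set M : ℕ := max N L with hM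
  set c : ℕ → ℂ := fun k => iteratedDeriv k f 0 / (k.factorial : ℂ) with hc
  set g : SchwartzMap ℝ ℂ := f - ∑ k ∈ Finset.range M, c k • ψ.powMul k with hg
  have hgx : ∀ x, g x = f x - ∑ k ∈ Finset.range M, c k * ψ.powMul k x := fun x => by
    simp [hg]
  have hvan : ∀ j < M, iteratedDeriv j g 0 = 0 := fun j hj => by
    have h1 : g =ᶠ[𝓝 0] fun x => f x - ∑ k ∈ Finset.range M, c k * (x : ℂ) ^ k := by
      filter_upwards [hψ] with x hx
      rw [hgx]
      congr 1
      exact Finset.sum_congr rfl fun k _ => by rw [powMul_apply, hx, mul_one]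
    have hcd : ∀ k, ContDiffAt ℝ j (fun x : ℝ => (x : ℂ) ^ k) 0 := fun k =>
      (Complex.ofRealCLM.contDiff.pow k).contDiffAt
    rw [h1.iteratedDeriv_eq j, iteratedDeriv_fun_sub (f.smooth j).contDiffAt
      (ContDiffAt.sum fun k _ => contDiffAt_const.mul (hcd k)), iteratedDeriv_fun_sum
      (fun k _ => contDiffAt_const.mul (hcd k)), Finset.sum_congr rfl fun k _ => by
        rw [iteratedDeriv_const_mul _ (hcd k), iteratedDeriv_ofReal_pow_zero, mul_ite, mul_zero]]
    rw [Finset.sum_ite_eq, if_pos (Finset.mem_range.2 hj), hc]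
    have : (j.factorial : ℂ) ≠ 0 := by exact_mod_cast j.factorial_ne_zero
    rw [div_mul_cancel₀ _ this, sub_self]
  have hLM : (n : ℝ) * p ≤ M := hL.trans (by exact_mod_cast le_max_right N L)
  -- `g` is Schwartz, so its order at infinity is free; `n p - 2` leaves `-2 < -1` after `n` steps.
  have hgO := (g.symbolBound n (n * p - 2) hvan).isBigO hp (by linarith) (by linarith) hn
  have hcut := IsBigO.sum (s := Finset.range M) fun k _ =>
    (isBigO_laplace_cutoff_monomial hp k ((N + 1 : ℝ) / p) hψ).const_mul_left (c k)
  have htail := IsBigO.sum (s := Finset.Ico N M) fun k hk =>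
    (isBigO_laplaceModel hp (Finset.mem_Ico.1 hk).1).const_mul_left (c k)
  refine ((hgO.add hcut).add htail).congr' ?_ EventuallyEq.rfl
  filter_upwards [eventually_rightHalfPlaneAtInfty 1] with z hz
  have hint : ∀ F : SchwartzMap ℝ ℂ, IntegrableOn
      (fun y : ℝ => Complex.exp (-z * ((y ^ p : ℝ) : ℂ)) * F y) (Ioi 0) := fun F =>
    integrableOn_exp_mul_of_powerBound (A := 0) (B := 0) F.continuous.continuousOn
      (by exact_mod_cast F.powerBound (M := 0) 0 (by simp)) (by norm_num) hp hz.2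
  have hsplit : (∫ y in Ioi (0 : ℝ), Complex.exp (-z * ((y ^ p : ℝ) : ℂ)) * f y) =
      (∫ y in Ioi (0 : ℝ), Complex.exp (-z * ((y ^ p : ℝ) : ℂ)) * g y) +
      ∑ k ∈ Finset.range M, c k *
        ∫ y in Ioi (0 : ℝ), Complex.exp (-z * ((y ^ p : ℝ) : ℂ)) * ψ.powMul k y := by
    simp_rw [← integral_const_mul]
    rw [← integral_finsetSum _ fun k _ => (hint _).const_mul (c k), ← integral_add (hint g)
      (integrable_finsetSum _ fun k _ => (hint _).const_mul (c k))]
    refine setIntegral_congr_fun measurableSet_Ioi fun y _ => ?_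
    simp only [hgx, mul_sub, Finset.mul_sum]
    rw [eq_comm, sub_add, sub_eq_self, sub_eq_zero]
    exact Finset.sum_congr rfl fun k _ => by ring
  have hsum := Finset.sum_range_add_sum_Ico (fun k => c k * laplaceModel p k z) (le_max_left N L)
  rw [← hM] at hsum
  simp only [Finset.sum_apply, mul_sub, Finset.sum_sub_distrib]
  rw [hsplit, ← hsum]
  ring

/-! ### Boundary values on the imaginary axis. -/

theorem mem_slitPlane_neg_I_mul {s lam : ℝ} (hs : s = 1 ∨ s = -1) (hlam : 0 < lam) :
    -(s * Complex.I * lam) ∈ Complex.slitPlane := by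
  right
  rcases hs with rfl | rfl <;> simp [hlam.ne']

/-- The principal logarithm of `-isλ` is `log λ - isπ/2`; this is the source of the phase in
`genFresnel`. -/
theorem neg_I_mul_cpow {s lam : ℝ} (hs : s = 1 ∨ s = -1) (hlam : 0 < lam) (α : ℝ) :
    (-(s * Complex.I * lam)) ^ (((-α : ℝ)) : ℂ) =
      Complex.exp (s * Complex.I * (Real.pi / 2) * α) * ((lam ^ (-α) : ℝ) : ℂ) := by
  have hlog : Complex.log (-(s * Complex.I * lam)) =
      Real.log lam + -(s * Complex.I * (Real.pi / 2)) := by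
    have e : -(s * Complex.I * lam) = (lam : ℂ) * -(s * Complex.I) := by ring
    have hne : -((s : ℂ) * Complex.I) ≠ 0 := by
      rcases hs with rfl | rfl <;> simp
    rw [e, Complex.log_ofReal_mul hlam hne]
    congr 1
    rcases hs with rfl | rfl
    · simp only [Complex.ofReal_one, one_mul, Complex.log_neg_I]; ring
    · simp only [Complex.ofReal_neg, Complex.ofReal_one, neg_mul, one_mul, neg_neg, Complex.log_I]
      ring
  rw [Complex.cpow_def_of_ne_zero (Complex.slitPlane_ne_zero (mem_slitPlane_neg_I_mul hs hlam)),
    hlog, Real.rpow_def_of_pos hlam, Complex.ofReal_exp, ← Complex.exp_add]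
  congr 1
  push_cast
  ring

theorem laplaceModel_neg_I_mul {s lam : ℝ} (hs : s = 1 ∨ s = -1) (hlam : 0 < lam) (p : ℝ) (k : ℕ) :
    laplaceModel p k (-(s * Complex.I * lam)) =
      genFresnel s p (k + 1) * ((lam ^ (-((k + 1 : ℝ) / p)) : ℝ) : ℂ) := by
  rw [laplaceModel, genFresnel, neg_I_mul_cpow hs hlam]
  push_cast
  ring

theorem norm_sign_mul_I_mul {s lam : ℝ} (hs : s = 1 ∨ s = -1) (hlam : 0 < lam) :
    ‖-((s : ℂ) * Complex.I * lam)‖ = lam := by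
  rcases hs with rfl | rfl <;> simp [abs_of_pos hlam]

theorem SchwartzMap.tendsto_laplace_boundary (f : SchwartzMap ℝ ℂ) (p s lam : ℝ) :
    Tendsto (fun δ : ℝ => ∫ y in Ioi (0 : ℝ),
      Complex.exp (-((δ : ℂ) + -(s * Complex.I * lam)) * ((y ^ p : ℝ) : ℂ)) * f y) (𝓝[>] 0)
      (𝓝 (∫ y in Ioi (0 : ℝ), Complex.exp (s * Complex.I * lam * ((y ^ p : ℝ) : ℂ)) * f y)) := by
  refine tendsto_integral_filter_of_dominated_convergence (fun y => ‖f y‖) ?_ ?_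
    f.integrable.norm.integrableOn ?_
  · exact Eventually.of_forall fun δ => ((continuousOn_exp_neg_mul_rpow _ p).mul
      f.continuous.continuousOn).aestronglyMeasurable measurableSet_Ioi
  · filter_upwards [self_mem_nhdsWithin] with δ hδ
    filter_upwards [ae_restrict_mem measurableSet_Ioi] with y hy
    rw [norm_mul, norm_exp_neg_mul_rpow]
    refine mul_le_of_le_one_left (norm_nonneg _) (Real.exp_le_one_iff.2 ?_)
    have h1 := Real.rpow_nonneg (le_of_lt hy) p
    have h2 : (0 : ℝ) < δ := hδ
    simp
    positivity
  · refine Eventually.of_forall fun y => ?_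
    have : Continuous fun δ : ℝ =>
        Complex.exp (-((δ : ℂ) + -(s * Complex.I * lam)) * ((y ^ p : ℝ) : ℂ)) * f y := by
      fun_prop
    refine (this.tendsto' 0 _ ?_).mono_left nhdsWithin_le_nhds
    simp

/-- Stationary phase at `0` for the phase `y ^ p` on the half-line, for Schwartz amplitudes. -/
theorem SchwartzMap.isBigO_oscillatory (f : SchwartzMap ℝ ℂ) {s p : ℝ} (hs : s = 1 ∨ s = -1)
    (hp : 0 < p) (N : ℕ) :
    (fun lam : ℝ => (∫ y in Ioi (0 : ℝ),
        Complex.exp (s * Complex.I * lam * ((y ^ p : ℝ) : ℂ)) * f y) -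
      ∑ k ∈ Finset.range N, iteratedDeriv k f 0 / (k.factorial : ℂ) *
        (genFresnel s p (k + 1) * ((lam ^ (-((k + 1 : ℝ) / p)) : ℝ) : ℂ)))
      =O[atTop] fun lam => lam ^ (-((N + 1 : ℝ) / p)) := by
  -- One constant serves all `z` with `|z|` large and `Re z > 0`, so the inequality at `z = δ - isλ`
  -- survives `δ → 0+`.
  obtain ⟨C, hC⟩ := (f.isBigO_laplace hp N).bound
  rw [rightHalfPlaneAtInfty, eventually_inf_principal,
    (hasBasis_cobounded_norm).eventually_iff] at hC
  obtain ⟨R, -, hR⟩ := hC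
  refine IsBigO.of_bound C ?_
  filter_upwards [eventually_gt_atTop (max R 0)] with lam hlam
  have hlam0 : 0 < lam := (le_max_right _ _).trans_lt hlam
  have hw : Tendsto (fun δ : ℝ => (δ : ℂ) + -(s * Complex.I * lam)) (𝓝[>] 0)
      (𝓝 (-(s * Complex.I * lam))) := by
    have : Continuous fun δ : ℝ => (δ : ℂ) + -(s * Complex.I * lam) := by fun_prop
    exact (this.tendsto' 0 _ (by simp)).mono_left nhdsWithin_le_nhds
  have hmodel : ∀ k, Tendsto (fun δ : ℝ => laplaceModel p k ((δ : ℂ) + -(s * Complex.I * lam)))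
      (𝓝[>] 0) (𝓝 (genFresnel s p (k + 1) * ((lam ^ (-((k + 1 : ℝ) / p)) : ℝ) : ℂ))) := fun k => by
    rw [← laplaceModel_neg_I_mul hs hlam0]
    have : ContinuousAt (laplaceModel p k) (-(s * Complex.I * lam)) :=
      continuousAt_const.mul (continuousAt_id.cpow continuousAt_const
        (mem_slitPlane_neg_I_mul hs hlam0))
    exact this.tendsto.comp hw
  have hlim := (f.tendsto_laplace_boundary p s lam).sub (tendsto_finsetSum (Finset.range N)
    fun k _ => (hmodel k).const_mul (iteratedDeriv k f 0 / (k.factorial : ℂ)))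
  have hnorm : Tendsto (fun δ : ℝ => C * ‖‖(δ : ℂ) + -(s * Complex.I * lam)‖ ^
      (-((N + 1 : ℝ) / p))‖) (𝓝[>] 0) (𝓝 (C * ‖lam ^ (-((N + 1 : ℝ) / p))‖)) := by
    have h := hw.norm
    rw [norm_sign_mul_I_mul hs hlam0] at h
    exact ((h.rpow_const (Or.inl hlam0.ne')).norm).const_mul C
  refine le_of_tendsto_of_tendsto hlim.norm hnorm ?_
  have hRe : ∀ᶠ δ : ℝ in 𝓝[>] 0, R < ‖(δ : ℂ) + -(s * Complex.I * lam)‖ := by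
    have h := hw.norm
    rw [norm_sign_mul_I_mul hs hlam0] at h
    exact h.eventually (lt_mem_nhds ((le_max_left _ _).trans_lt hlam))
  filter_upwards [hRe, self_mem_nhdsWithin] with δ h1 h2
  refine hR h1.le ?_
  have : (0 : ℝ) < δ := h2
  simpa using this

/-! ### Values of the oscillatory integrals. -/

theorem SchwartzMap.iteratedDeriv_powMul_zero (χ : SchwartzMap ℝ ℂ) (h1 : χ 0 = 1) {j k : ℕ}
    (hj : j ≤ k) : iteratedDeriv j (χ.powMul k) 0 = if j = k then (k.factorial : ℂ) else 0 := by
  have h : ⇑(χ.powMul k) = (fun x : ℝ => (x : ℂ) ^ k) * ⇑χ := by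
    funext x
    exact SchwartzMap.powMul_apply k χ x
  have hc : ContDiffAt ℝ j (fun x : ℝ => (x : ℂ) ^ k) 0 :=
    (Complex.ofRealCLM.contDiff.pow k).contDiffAt
  rw [h, iteratedDeriv_mul hc (χ.smooth j).contDiffAt]
  simp_rw [iteratedDeriv_ofReal_pow_zero, mul_ite, ite_mul, mul_zero, zero_mul]
  rw [Finset.sum_ite_eq']
  by_cases hjk : j = k
  · subst hjk
    simp [h1]
  · rw [if_neg hjk, if_neg]
    simp only [Finset.mem_range]
    omega

/-- Substituting `y = εx` gives `ε^(-(k+1))` times the oscillatory integral of `y^k χ(y)` at `λ =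
ε^(-p)`. In the expansion with `k + 1` terms only the term `k` survives, and it scales to the
constant; the error is `ε^(-(k+1)) ε^(k+2) = ε`. -/
theorem hasOscIntegral_genFresnel {s p : ℝ} (hs : s = 1 ∨ s = -1) (hp : 0 < p) (k : ℕ) :
    HasOscIntegral (fun x => s * x ^ p) (fun x => (x : ℂ) ^ k) (genFresnel s p (k + 1)) := by
  intro χ hχ
  have hO := (χ.powMul k).isBigO_oscillatory hs hp (k + 1)
  have hsum : ∀ G : ℕ → ℂ, ∑ j ∈ Finset.range (k + 1),
      iteratedDeriv j (χ.powMul k) 0 / (j.factorial : ℂ) * G j = G k := fun G => by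
    rw [Finset.sum_range_succ, Finset.sum_eq_zero fun j hj => ?_,
      χ.iteratedDeriv_powMul_zero hχ le_rfl, if_pos rfl,
      div_self (by exact_mod_cast k.factorial_ne_zero), one_mul, zero_add]
    have hj := Finset.mem_range.1 hj
    rw [χ.iteratedDeriv_powMul_zero hχ hj.le, if_neg hj.ne, zero_div, zero_mul]
  simp only [hsum] at hO
  have hlam : Tendsto (fun ε : ℝ => ε ^ (-p)) (𝓝[>] 0) atTop :=
    tendsto_rpow_neg_nhdsGT_zero (by linarith)
  have hscale : (fun ε : ℝ => ((ε ^ (-(k + 1 : ℝ)) : ℝ) : ℂ)) =O[𝓝[>] 0]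
      fun ε : ℝ => ε ^ (-(k + 1 : ℝ)) :=
    IsBigO.of_bound 1 (Eventually.of_forall fun ε => by rw [Complex.norm_real, one_mul])
  have hO2 := hscale.mul (hO.comp_tendsto hlam)
  have hid : Tendsto (fun ε : ℝ => ε) (𝓝[>] 0) (𝓝 0) := nhdsWithin_le_nhds
  have hpow : ∀ ε : ℝ, 0 < ε → ∀ q : ℝ, (ε ^ (-p)) ^ (-(q / p)) = ε ^ q := fun ε hε q => by
    rw [← Real.rpow_mul hε.le]
    congr 1
    field_simp
  have hO3 : (fun ε : ℝ => ε ^ (-(k + 1 : ℝ)) *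
      ((fun lam : ℝ => lam ^ (-(((k + 1 : ℕ) + 1 : ℝ) / p))) ∘ fun ε : ℝ => ε ^ (-p)) ε)
      =ᶠ[𝓝[>] 0] fun ε => ε := by
    filter_upwards [self_mem_nhdsWithin] with ε hε
    have hε : 0 < ε := hε
    simp only [Function.comp_apply]
    rw [hpow ε hε, ← Real.rpow_add hε]
    push_cast
    ring_nf
    rw [Real.rpow_one]
  have hlim := (hO2.trans_eventuallyEq hO3).trans_tendsto hid
  rw [← tendsto_sub_nhds_zero_iff]
  refine hlim.congr' ?_
  filter_upwards [self_mem_nhdsWithin] with ε hε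
  have hε : 0 < ε := hε
  simp only [Function.comp_apply]
  have hsc := integral_comp_mul_left_Ioi (fun y : ℝ =>
    ((ε ^ (-(k : ℝ)) : ℝ) : ℂ) * (Complex.exp (s * Complex.I * ((ε ^ (-p) : ℝ) : ℂ) *
      ((y ^ p : ℝ) : ℂ)) * χ.powMul k y)) 0 hε
  rw [mul_zero, integral_const_mul (μ := volume.restrict (Ioi 0)) (((ε ^ (-(k : ℝ)) : ℝ) : ℂ))
    (fun y : ℝ => Complex.exp (s * Complex.I * ((ε ^ (-p) : ℝ) : ℂ) *
      ((y ^ p : ℝ) : ℂ)) * χ.powMul k y)] at hsc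
  have hcong : ∀ x ∈ Ioi (0 : ℝ), ((ε ^ (-(k : ℝ)) : ℝ) : ℂ) *
      (Complex.exp (s * Complex.I * ((ε ^ (-p) : ℝ) : ℂ) *
      (((ε * x) ^ p : ℝ) : ℂ)) * χ.powMul k (ε * x)) =
      Complex.exp (Complex.I * ((s * x ^ p : ℝ) : ℂ)) * (x : ℂ) ^ k * χ (ε * x) := fun x hx => by
    have hx : 0 < x := hx
    have e1 : ε ^ (-p) * (ε * x) ^ p = x ^ p := by
      rw [Real.mul_rpow hε.le hx.le, ← mul_assoc, ← Real.rpow_add hε]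
      simp
    have e2 : ε ^ (-(k : ℝ)) * (ε * x) ^ k = x ^ k := by
      rw [mul_pow, ← mul_assoc, ← Real.rpow_natCast ε k, ← Real.rpow_add hε]
      simp
    rw [SchwartzMap.powMul_apply, ← e1, ← Complex.ofReal_pow, ← Complex.ofReal_pow, ← e2]
    push_cast
    ring_nf
  rw [setIntegral_congr_fun measurableSet_Ioi hcong] at hsc
  have e3 : ε⁻¹ * ε ^ (-(k : ℝ)) = ε ^ (-(k + 1 : ℝ)) := by
    rw [← Real.rpow_neg_one, ← Real.rpow_add hε]
    ring_nf
  have e4 : ε ^ (-(k + 1 : ℝ)) * ε ^ (k + 1 : ℝ) = 1 := by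
    rw [← Real.rpow_add hε, neg_add_cancel, Real.rpow_zero]
  rw [hsc, mul_sub, Complex.real_smul, mul_left_comm _ (genFresnel _ _ _), hpow ε hε,
    ← Complex.ofReal_mul, e4, Complex.ofReal_one, mul_one, ← mul_assoc, ← Complex.ofReal_mul, e3]

/-! ### The Lambert function and the change of variables. -/

theorem lambertW0_mul_exp {y : ℝ} (hy : -Real.exp (-1) < y) :
    lambertW0 y * Real.exp (lambertW0 y) = y :=
  ((lambertW0_eq_iff hy.le _).1 rfl).2

theorem neg_one_lt_lambertW0 {y : ℝ} (hy : -Real.exp (-1) < y) : -1 < lambertW0 y := by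
  refine lt_of_le_of_ne ((lambertW0_eq_iff hy.le _).1 rfl).1 fun h => ?_
  have := lambertW0_mul_exp hy
  rw [← h] at this
  linarith

theorem neg_exp_neg_one_lt_mul_exp {x : ℝ} (hx : -1 < x) : -Real.exp (-1) < x * Real.exp x := by
  simpa using strictMonoOn_mul_exp (mem_Ici.2 le_rfl) (mem_Ici.2 hx.le) hx

theorem hasDerivAt_mul_exp (x : ℝ) :
    HasDerivAt (fun x : ℝ => x * Real.exp x) ((1 + x) * Real.exp x) x :=
  ((hasDerivAt_id x).mul (Real.hasDerivAt_exp x)).congr_deriv (by simp only [id]; ring)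

/-- The derivative `(1 + x) e^x` is nonzero for `x > -1`, so a smooth local inverse exists. By
continuity its values stay above `-1`, and uniqueness on that branch identifies it with `lambertW0`.
-/
theorem contDiffAt_lambertW0 {y : ℝ} (hy : -Real.exp (-1) < y) : ContDiffAt ℝ ∞ lambertW0 y := by
  set x := lambertW0 y with hx
  have hx1 : -1 < x := neg_one_lt_lambertW0 hy
  have hxy : x * Real.exp x = y := lambertW0_mul_exp hy
  have hne : (1 + x) * Real.exp x ≠ 0 := (mul_pos (by linarith) (Real.exp_pos x)).ne'
  have hf : ContDiffAt ℝ ∞ (fun x : ℝ => x * Real.exp x) x :=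
    (contDiff_id.mul Real.contDiff_exp).contDiffAt
  have hf' := (hasDerivAt_mul_exp x).hasFDerivAt_equiv hne
  have hn : (∞ : WithTop ℕ∞) ≠ 0 := by simp
  have hg := hf.to_localInverse hf' hn
  have hs := hf.hasStrictFDerivAt' hf' hn
  have hri := hs.eventually_right_inverse
  have hgx : hf.localInverse hf' hn (x * Real.exp x) = x := hs.localInverse_apply_image
  have hgt : ∀ᶠ w in 𝓝 (x * Real.exp x), -1 < hf.localInverse hf' hn w :=
    hg.continuousAt.eventually (lt_mem_nhds (by rw [hgx]; exact hx1))
  rw [hxy] at hri hgt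
  simp only [hxy] at hg
  refine hg.congr_of_eventuallyEq ?_
  filter_upwards [hri, hgt, lt_mem_nhds hy] with w h1 h2 h3
  exact (lambertW0_eq_iff h3.le _).2 ⟨h2.le, h1⟩

/-- Differentiating `W e^W = y` gives `(1 + W) e^W W' = 1`. The sign removes the absolute value from
the Jacobian. -/
theorem deriv_lambertW0_pos {y : ℝ} (hy : -Real.exp (-1) < y) : 0 < deriv lambertW0 y := by
  have hd := ((contDiffAt_lambertW0 hy).differentiableAt (by simp)).hasDerivAt
  have h1 := (hasDerivAt_mul_exp (lambertW0 y)).comp y hd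
  have h2 : HasDerivAt ((fun x : ℝ => x * Real.exp x) ∘ lambertW0) 1 y := by
    refine (hasDerivAt_id y).congr_of_eventuallyEq ?_
    filter_upwards [lt_mem_nhds hy] with w hw using lambertW0_mul_exp hw
  have h3 := h1.unique h2
  have h4 : 0 < (1 + lambertW0 y) * Real.exp (lambertW0 y) :=
    mul_pos (by linarith [neg_one_lt_lambertW0 hy]) (Real.exp_pos _)
  exact pos_of_mul_pos_right (by rw [h3]; exact one_pos) h4.le

theorem neg_exp_lt_div {p y : ℝ} (hp : 0 < p) (hy : y ∈ Ioi (-(p * Real.exp (-1)))) :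
    -Real.exp (-1) < y / p := by
  rw [lt_div_iff₀ hp]
  linarith [mem_Ioi.1 hy]

theorem lambertPhi_mul_exp {p y : ℝ} (hp : 0 < p) (hy : y ∈ Ioi (-(p * Real.exp (-1)))) :
    lambertPhi p y * Real.exp (lambertPhi p y / p) = y := by
  rw [lambertPhi, mul_div_cancel_left₀ _ hp.ne', mul_assoc,
    lambertW0_mul_exp (neg_exp_lt_div hp hy), mul_div_cancel₀ _ hp.ne']

theorem mul_exp_div_mem {p x : ℝ} (hp : 0 < p) (hx : x ∈ Ioi (-p)) :
    x * Real.exp (x / p) ∈ Ioi (-(p * Real.exp (-1))) := by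
  have h1 : -1 < x / p := by
    rw [lt_div_iff₀ hp]; linarith [mem_Ioi.1 hx]
  have h2 := mul_lt_mul_of_pos_left (neg_exp_neg_one_lt_mul_exp h1) hp
  rw [← mul_assoc, mul_div_cancel₀ _ hp.ne'] at h2
  rw [mem_Ioi]
  linarith

theorem lambertPhi_mul_exp_div {p x : ℝ} (hp : 0 < p) (hx : x ∈ Ioi (-p)) :
    lambertPhi p (x * Real.exp (x / p)) = x := by
  have h := neg_exp_lt_div hp (mul_exp_div_mem hp hx)
  have h1 : -1 ≤ x / p := by
    rw [le_div_iff₀ hp]; linarith [mem_Ioi.1 hx]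
  rw [lambertPhi, (lambertW0_eq_iff h.le (x / p)).2 ⟨h1, by ring⟩, mul_div_cancel₀ _ hp.ne']

theorem lambertPhi_mem {p y : ℝ} (hp : 0 < p) (hy : y ∈ Ioi (-(p * Real.exp (-1)))) :
    lambertPhi p y ∈ Ioi (-p) := by
  have := mul_lt_mul_of_pos_left (neg_one_lt_lambertW0 (neg_exp_lt_div hp hy)) hp
  rw [mem_Ioi, lambertPhi]
  linarith

theorem injOn_lambertPhi {p : ℝ} (hp : 0 < p) :
    InjOn (lambertPhi p) (Ioi (-(p * Real.exp (-1)))) := fun y hy z hz h => by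
  rw [← lambertPhi_mul_exp hp hy, ← lambertPhi_mul_exp hp hz, h]

theorem bijOn_lambertPhi {p : ℝ} (hp : 0 < p) :
    BijOn (lambertPhi p) (Ioi (-(p * Real.exp (-1)))) (Ioi (-p)) :=
  ⟨fun _ hy => lambertPhi_mem hp hy, injOn_lambertPhi hp, fun _ hx =>
    ⟨_, mul_exp_div_mem hp hx, lambertPhi_mul_exp_div hp hx⟩⟩

theorem contDiffAt_lambertPhi {p y : ℝ} (hp : 0 < p) (hy : y ∈ Ioi (-(p * Real.exp (-1)))) :
    ContDiffAt ℝ ∞ (lambertPhi p) y :=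
  contDiffAt_const.mul ((contDiffAt_lambertW0 (neg_exp_lt_div hp hy)).comp y
    (contDiffAt_id.div_const p))

theorem hasDerivAt_lambertPhi {p y : ℝ} (hp : 0 < p) (hy : y ∈ Ioi (-(p * Real.exp (-1)))) :
    HasDerivAt (lambertPhi p) (deriv lambertW0 (y / p)) y := by
  have hd := ((contDiffAt_lambertW0 (neg_exp_lt_div hp hy)).differentiableAt
    (by simp)).hasDerivAt
  refine ((hd.comp y ((hasDerivAt_id y).div_const p)).const_mul p).congr_deriv ?_
  field_simp

theorem contDiffAt_deriv_lambertW0 {y : ℝ} (hy : -Real.exp (-1) < y) :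
    ContDiffAt ℝ ∞ (deriv lambertW0) y := by
  have h : ContDiffOn ℝ ∞ lambertW0 (Ioi (-Real.exp (-1))) := fun z hz =>
    (contDiffAt_lambertW0 hz).contDiffWithinAt
  exact (h.deriv_of_isOpen isOpen_Ioi (by simp)).contDiffAt (Ioi_mem_nhds hy)

theorem zero_mem_Ioi_neg_mul_exp {p : ℝ} (hp : 0 < p) :
    (0 : ℝ) ∈ Ioi (-(p * Real.exp (-1))) := by
  have := mul_pos hp (Real.exp_pos (-1))
  rw [mem_Ioi]
  linarith

theorem lambertPhi_pos {p y : ℝ} (hp : 0 < p) (hy : 0 < y) : 0 < lambertPhi p y := by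
  have h := lambertPhi_mul_exp hp ((mem_Ioi.1 (zero_mem_Ioi_neg_mul_exp hp)).trans hy)
  rw [← h] at hy
  exact pos_of_mul_pos_left hy (Real.exp_pos _).le

theorem image_lambertPhi_Ioi_zero {p : ℝ} (hp : 0 < p) :
    lambertPhi p '' Ioi 0 = Ioi 0 := by
  ext x
  refine ⟨?_, fun hx => ?_⟩
  · rintro ⟨y, hy, rfl⟩
    exact lambertPhi_pos hp hy
  · have hx : 0 < x := hx
    exact ⟨_, mul_pos hx (Real.exp_pos _), lambertPhi_mul_exp_div hp (mem_Ioi.2 (by linarith))⟩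

/-! ### The pulled-back amplitude. -/

/-- The amplitude `a(Φ(y)) Φ'(y)`, extended by zero to the line. -/
noncomputable def lambertPullback (a : ℝ → ℂ) (p : ℝ) : ℝ → ℂ :=
  indicator (Ioi (-(p * Real.exp (-1))))
    fun y => a (p * lambertW0 (y / p)) * ((deriv lambertW0 (y / p) : ℝ) : ℂ)

theorem setIntegral_image_lambertPhi {p : ℝ} (hp : 0 < p) {S : Set ℝ} (hS : MeasurableSet S)
    (hsub : S ⊆ Ioi (-(p * Real.exp (-1)))) (e : ℝ → ℂ) (a : ℝ → ℂ) :
    ∫ x in lambertPhi p '' S, e x * a x =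
      ∫ y in S, e (lambertPhi p y) * lambertPullback a p y := by
  rw [integral_image_eq_integral_abs_deriv_smul hS
    (fun y hy => (hasDerivAt_lambertPhi hp (hsub hy)).hasDerivWithinAt)
    ((injOn_lambertPhi hp).mono hsub)]
  refine setIntegral_congr_fun hS fun y hy => ?_
  simp only [lambertPullback, indicator_of_mem (hsub hy)]
  rw [abs_of_pos (deriv_lambertW0_pos (neg_exp_lt_div hp (hsub hy))), Complex.real_smul,
    ← lambertPhi]
  ring

theorem iteratedDeriv_lambertPullback {p : ℝ} (hp : 0 < p) (a : ℝ → ℂ) (k : ℕ) :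
    iteratedDeriv k (lambertPullback a p) 0 = lambertDeriv a p k := by
  refine EventuallyEq.iteratedDeriv_eq k ?_
  filter_upwards [Ioi_mem_nhds (zero_mem_Ioi_neg_mul_exp hp)] with y hy
  rw [lambertPullback, indicator_of_mem hy]

section Pullback

variable {a : ℝ → ℂ} {p : ℝ}

theorem lambertPullback_eq_zero (hp : 0 < p) {y : ℝ}
    (hy : y ∉ (fun x : ℝ => x * Real.exp (x / p)) '' tsupport a) : lambertPullback a p y = 0 := by
  by_cases hmem : y ∈ Ioi (-(p * Real.exp (-1)))
  · rw [lambertPullback, indicator_of_mem hmem, ← lambertPhi,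
      image_eq_zero_of_notMem_tsupport (f := a) fun h => hy ⟨_, h, lambertPhi_mul_exp hp hmem⟩,
      zero_mul]
  · rw [lambertPullback, indicator_of_notMem hmem]

theorem isCompact_image_tsupport (hc : HasCompactSupport a) (p : ℝ) :
    IsCompact ((fun x : ℝ => x * Real.exp (x / p)) '' tsupport a) :=
  hc.isCompact.image (by fun_prop)

theorem hasCompactSupport_lambertPullback (hp : 0 < p) (hc : HasCompactSupport a) :
    HasCompactSupport (lambertPullback a p) :=
  HasCompactSupport.intro (isCompact_image_tsupport hc p) fun _ hy => lambertPullback_eq_zero hp hy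

/-- The support lies in the image of `tsupport a` under `x ↦ x e^{x/p}`, a compact subset of the
open half-line where `Φ` is smooth, so the extension by zero creates no singularity. -/
theorem contDiff_lambertPullback (hp : 0 < p) (ha : ContDiff ℝ ∞ a) (hc : HasCompactSupport a)
    (hsupp : tsupport a ⊆ Ioi (-p)) : ContDiff ℝ ∞ (lambertPullback a p) := by
  rw [contDiff_iff_contDiffAt]
  intro y
  by_cases hmem : y ∈ Ioi (-(p * Real.exp (-1)))
  · have h : ContDiffAt ℝ ∞
        (fun y => a (lambertPhi p y) * ((deriv lambertW0 (y / p) : ℝ) : ℂ)) y :=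
      (ha.contDiffAt.comp y (contDiffAt_lambertPhi hp hmem)).mul
        (Complex.ofRealCLM.contDiff.contDiffAt.comp y
          ((contDiffAt_deriv_lambertW0 (neg_exp_lt_div hp hmem)).comp y
            (contDiffAt_id.div_const p)))
    refine h.congr_of_eventuallyEq ?_
    filter_upwards [Ioi_mem_nhds hmem] with z hz
    rw [lambertPullback, indicator_of_mem hz, lambertPhi]
  · have hy : y ∉ (fun x : ℝ => x * Real.exp (x / p)) '' tsupport a := by
      rintro ⟨x, hx, rfl⟩
      exact hmem (mul_exp_div_mem hp (hsupp hx))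
    refine (contDiffAt_const (c := (0 : ℂ))).congr_of_eventuallyEq ?_
    filter_upwards [(isCompact_image_tsupport hc p).isClosed.isOpen_compl.mem_nhds hy] with z hz
    exact lambertPullback_eq_zero hp hz

end Pullback

/-! ### The two expansions. -/

theorem lambertPhi_rpow_mul_exp {p y : ℝ} (hp : 0 < p) (hy : 0 < y) :
    lambertPhi p y ^ p * Real.exp (lambertPhi p y) = y ^ p := by
  have hmem : y ∈ Ioi (-(p * Real.exp (-1))) :=
    (mem_Ioi.1 (zero_mem_Ioi_neg_mul_exp hp)).trans hy
  conv_rhs => rw [← lambertPhi_mul_exp hp hmem]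
  rw [Real.mul_rpow (lambertPhi_pos hp hy).le (Real.exp_pos _).le, ← Real.exp_mul,
    div_mul_cancel₀ _ hp.ne']

/-- A natural exponent needs no sign condition, so negative `y` is covered, as the integral over the
line requires. -/
theorem lambertPhi_pow_mul_exp {m : ℕ} (hm : 1 ≤ m) {y : ℝ}
    (hy : y ∈ Ioi (-((m : ℝ) * Real.exp (-1)))) :
    lambertPhi m y ^ m * Real.exp (lambertPhi m y) = y ^ m := by
  have hp : (0 : ℝ) < m := by exact_mod_cast hm
  conv_rhs => rw [← lambertPhi_mul_exp hp hy]
  rw [mul_pow, ← Real.exp_nat_mul, mul_div_cancel₀ _ hp.ne']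

/-- The half-line expansion, for amplitudes supported where the change of variables is defined. -/
theorem isBigO_lambert_halfLine_of_tsupport {a : ℝ → ℂ} (ha : ContDiff ℝ ∞ a)
    (hc : HasCompactSupport a) {s p : ℝ} (hs : s = 1 ∨ s = -1) (hp : 0 < p)
    (hsupp : tsupport a ⊆ Ioi (-p)) (N : ℕ) :
    (fun lam : ℝ =>
      (∫ x in Ioi (0 : ℝ),
        Complex.exp (s * Complex.I * lam * ((x ^ p * Real.exp x : ℝ) : ℂ)) * a x) -
      ∑ k ∈ Finset.range N, genFresnel s p (k + 1) / (k.factorial : ℂ) * lambertDeriv a p k *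
        ((lam ^ (-((k + 1 : ℝ) / p)) : ℝ) : ℂ))
      =O[atTop] fun lam : ℝ => lam ^ (-((N + 1 : ℝ) / p)) := by
  have h := ((hasCompactSupport_lambertPullback hp hc).toSchwartzMap
    (contDiff_lambertPullback hp ha hc hsupp)).isBigO_oscillatory hs hp N
  refine h.congr_left fun lam => ?_
  have hI := setIntegral_image_lambertPhi hp measurableSet_Ioi
    (Ioi_subset_Ioi (le_of_lt (zero_mem_Ioi_neg_mul_exp hp)))
    (fun x => Complex.exp (s * Complex.I * lam * ((x ^ p * Real.exp x : ℝ) : ℂ))) a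
  rw [image_lambertPhi_Ioi_zero hp] at hI
  rw [hI]
  congr 1
  · refine setIntegral_congr_fun measurableSet_Ioi fun y hy => ?_
    simp only [lambertPhi_rpow_mul_exp hp hy]
    rfl
  · refine Finset.sum_congr rfl fun k _ => ?_
    rw [← iteratedDeriv_lambertPullback hp]
    change iteratedDeriv k (lambertPullback a p) 0 / _ * _ = _
    ring

/-- Only `x > 0` and the germ of `a` at `0` matter, so `a` may be cut off on the negative side to
meet the support condition. -/
theorem isBigO_lambert_halfLine {a : ℝ → ℂ} (ha : ContDiff ℝ ∞ a)
    (hc : HasCompactSupport a) {s p : ℝ} (hs : s = 1 ∨ s = -1) (hp : 0 < p) (N : ℕ) :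
    (fun lam : ℝ =>
      (∫ x in Ioi (0 : ℝ),
        Complex.exp (s * Complex.I * lam * ((x ^ p * Real.exp x : ℝ) : ℂ)) * a x) -
      ∑ k ∈ Finset.range N, genFresnel s p (k + 1) / (k.factorial : ℂ) * lambertDeriv a p k *
        ((lam ^ (-((k + 1 : ℝ) / p)) : ℝ) : ℂ))
      =O[atTop] fun lam : ℝ => lam ^ (-((N + 1 : ℝ) / p)) := by
  -- The affine argument is at least `1` for `x ≥ -p/4` and at most `0` for `x ≤ -p/2`.
  set θ : ℝ → ℂ := fun x => (Real.smoothTransition (2 + 4 / p * x) : ℂ) with hθ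
  have hθs : ContDiff ℝ ∞ θ := Complex.ofRealCLM.contDiff.comp
    (Real.smoothTransition.contDiff.comp (contDiff_const.add (contDiff_const.mul contDiff_id)))
  have hθ1 : ∀ x, -(p / 4) ≤ x → θ x = 1 := fun x hx => by
    have : 1 ≤ 2 + 4 / p * x := by
      have h := mul_le_mul_of_nonneg_left hx (by positivity : 0 ≤ 4 / p)
      have h2 : 4 / p * -(p / 4) = -1 := by field_simp
      linarith
    rw [hθ]
    simp only
    rw [Real.smoothTransition.one_of_one_le this, Complex.ofReal_one]
  have hsupp : tsupport (fun x => θ x * a x) ⊆ Ioi (-p) := by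
    refine (closure_minimal (fun x hx => ?_) isClosed_Ici :
      tsupport (fun x => θ x * a x) ⊆ Ici (-(p / 2))).trans fun x hx => ?_
    · by_contra hlt
      have hlt : x < -(p / 2) := not_le.1 hlt
      have h0 : 2 + 4 / p * x ≤ 0 := by
        have h := mul_le_mul_of_nonneg_left hlt.le (by positivity : 0 ≤ 4 / p)
        have h2 : 4 / p * -(p / 2) = -2 := by field_simp; norm_num
        linarith
      refine hx ?_
      simp only [hθ]
      rw [Real.smoothTransition.zero_of_nonpos h0, Complex.ofReal_zero, zero_mul]
    · have := mem_Ici.1 hx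
      rw [mem_Ioi]
      linarith
  have h := isBigO_lambert_halfLine_of_tsupport (hθs.mul ha) (hc.mul_left (f := θ)) hs hp hsupp N
  refine h.congr_left fun lam => ?_
  congr 1
  · refine setIntegral_congr_fun measurableSet_Ioi fun x hx => ?_
    have hx : 0 < x := hx
    rw [hθ1 x (by linarith), one_mul]
  · refine Finset.sum_congr rfl fun k _ => ?_
    congr 2
    refine EventuallyEq.iteratedDeriv_eq k ?_
    have hcont : ContinuousAt (lambertPhi p) 0 :=
      (contDiffAt_lambertPhi hp (zero_mem_Ioi_neg_mul_exp hp)).continuousAt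
    have h0 : lambertPhi p 0 = 0 := by
      simpa using lambertPhi_mul_exp_div (x := 0) hp (mem_Ioi.2 (by linarith))
    filter_upwards [hcont.eventually (lt_mem_nhds (show -(p / 4) < lambertPhi p 0 by
      rw [h0]; linarith))] with y hy
    rw [← lambertPhi, hθ1 _ hy.le, one_mul]

/-- The two-sided expansion. -/
theorem isBigO_lambert_line {a : ℝ → ℂ} (ha : ContDiff ℝ ∞ a) (hc : HasCompactSupport a) {s : ℝ}
    (hs : s = 1 ∨ s = -1) {m : ℕ} (hm : 1 ≤ m) (hsupp : tsupport a ⊆ Ioi (-(m : ℝ))) (N : ℕ) :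
    (fun lam : ℝ =>
      (∫ x : ℝ, Complex.exp (s * Complex.I * lam * ((x ^ m * Real.exp x : ℝ) : ℂ)) * a x) -
      ∑ k ∈ Finset.range N, fresnelCoeff s m k / (k.factorial : ℂ) * lambertDeriv a m k *
        ((lam ^ (-((k + 1 : ℝ) / m)) : ℝ) : ℂ))
      =O[atTop] fun lam : ℝ => lam ^ (-((N + 1 : ℝ) / m)) := by
  have hp : (0 : ℝ) < m := by exact_mod_cast hm
  have hbc := hasCompactSupport_lambertPullback hp hc
  have hbs := contDiff_lambertPullback hp ha hc hsupp
  have hs' : s * (-1) ^ m = 1 ∨ s * (-1) ^ m = -1 := by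
    rcases hs with rfl | rfl <;> rcases neg_one_pow_eq_or ℝ m with h | h <;> simp [h]
  have h1 := (hbc.toSchwartzMap hbs).isBigO_oscillatory hs hp N
  -- The half-line `y < 0` is reflected: `(-y)^m = (-1)^m y^m` changes the sign of the phase to `s
  -- (-1)^m`, and the `k`-th derivative of the reflected amplitude at `0` acquires `(-1)^k`.
  have h2 := ((hbc.comp_homeomorph (Homeomorph.neg ℝ)).toSchwartzMap
    (hbs.comp contDiff_neg)).isBigO_oscillatory hs' hp N
  refine (h1.add h2).congr_left fun lam => ?_
  have hI : (∫ x : ℝ, Complex.exp (s * Complex.I * lam * ((x ^ m * Real.exp x : ℝ) : ℂ)) * a x) =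
      ∫ y : ℝ, Complex.exp (s * Complex.I * lam * ((y ^ m : ℝ) : ℂ)) * lambertPullback a m y := by
    rw [← setIntegral_eq_integral_of_forall_compl_eq_zero (s := Ioi (-(m : ℝ))) fun x hx => by
        rw [image_eq_zero_of_notMem_tsupport fun h => hx (hsupp h), mul_zero],
      ← setIntegral_eq_integral_of_forall_compl_eq_zero (s := Ioi (-((m : ℝ) * Real.exp (-1))))
        (f := fun y : ℝ => Complex.exp (s * Complex.I * lam * ((y ^ m : ℝ) : ℂ)) *
          lambertPullback a m y) fun y hy => by
        rw [lambertPullback, indicator_of_notMem hy, mul_zero],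
      ← (bijOn_lambertPhi hp).image_eq, setIntegral_image_lambertPhi hp measurableSet_Ioi le_rfl]
    refine setIntegral_congr_fun measurableSet_Ioi fun y hy => ?_
    simp only [lambertPhi_pow_mul_exp hm hy]
  have hint : Integrable fun y : ℝ =>
      Complex.exp (s * Complex.I * lam * ((y ^ m : ℝ) : ℂ)) * lambertPullback a m y := by
    refine Continuous.integrable_of_hasCompactSupport ?_ hbc.mul_left
    exact Continuous.mul (by fun_prop) hbs.continuous
  have hsplit := intervalIntegral.integral_Iic_add_Ioi (b := (0 : ℝ)) (μ := volume)
    hint.integrableOn hint.integrableOn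
  have hneg := integral_comp_neg_Ioi (0 : ℝ) fun y : ℝ =>
    Complex.exp (s * Complex.I * lam * ((y ^ m : ℝ) : ℂ)) * lambertPullback a m y
  rw [neg_zero] at hneg
  rw [hI, ← hsplit, ← hneg, add_comm (∫ y in Ioi (0 : ℝ), _ : ℂ), sub_add_sub_comm,
    ← Finset.sum_add_distrib]
  congr 1
  · congr 1
    · refine setIntegral_congr_fun measurableSet_Ioi fun y _ => ?_
      simp only [Real.rpow_natCast]
      rfl
    · refine setIntegral_congr_fun measurableSet_Ioi fun y _ => ?_
      simp only [Real.rpow_natCast]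
      rw [neg_pow]
      push_cast
      ring_nf
      rfl
  · refine Finset.sum_congr rfl fun k _ => ?_
    rw [← iteratedDeriv_lambertPullback hp]
    change iteratedDeriv k (lambertPullback a m) 0 / _ * _ +
      iteratedDeriv k (fun x => lambertPullback a m (-x)) 0 / _ * _ = _
    rw [iteratedDeriv_comp_neg, neg_zero, fresnelCoeff, Complex.real_smul]
    push_cast
    ring

theorem corollary6p5 (a : ℝ → ℂ) (ha : ContDiff ℝ ∞ a) (hsupp : HasCompactSupport a)
    (s : ℝ) (hs : s = 1 ∨ s = -1) :
    (∀ p : ℝ, 0 < p →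
      -- the change of variables `Φ(y) = p W₀(y/p)`, inverse to `x ↦ x e^{x/p}`
      (BijOn (lambertPhi p) (Ioi (-(p * Real.exp (-1)))) (Ioi (-p)) ∧
        ContDiffOn ℝ ∞ (lambertPhi p) (Ioi (-(p * Real.exp (-1)))) ∧
        ∀ y ∈ Ioi (-(p * Real.exp (-1))),
          lambertPhi p y * Real.exp (lambertPhi p y / p) = y ∧
          HasDerivAt (lambertPhi p) (deriv lambertW0 (y / p)) y) ∧
      -- the constants are the values of the oscillatory integrals `Os-∫₀^∞ e^{±i x^p} x^k dx`
      (∀ k : ℕ, HasOscIntegral (fun x => s * x ^ p) (fun x => (x : ℂ) ^ k)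
        (genFresnel s p (k + 1))) ∧
      -- the expansion on the half-line
      ∀ N : ℕ, 1 ≤ N →
        (fun lam : ℝ =>
          (∫ x in Ioi (0 : ℝ),
            Complex.exp (s * Complex.I * lam * ((x ^ p * Real.exp x : ℝ) : ℂ)) * a x) -
          ∑ k ∈ Finset.range N, genFresnel s p (k + 1) / (k.factorial : ℂ) * lambertDeriv a p k *
            ((lam ^ (-((k + 1 : ℝ) / p)) : ℝ) : ℂ))
        =O[atTop] fun lam : ℝ => lam ^ (-((N + 1 - (p - ⌊p⌋)) / p))) ∧
    -- the expansion on the line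
    (∀ m : ℕ, 1 ≤ m → tsupport a ⊆ Ioi (-(m : ℝ)) →
      ∀ N : ℕ, 1 ≤ N →
        (fun lam : ℝ =>
          (∫ x : ℝ,
            Complex.exp (s * Complex.I * lam * ((x ^ m * Real.exp x : ℝ) : ℂ)) * a x) -
          ∑ k ∈ Finset.range N, fresnelCoeff s m k / (k.factorial : ℂ) * lambertDeriv a m k *
            ((lam ^ (-((k + 1 : ℝ) / m)) : ℝ) : ℂ))
        =O[atTop] fun lam : ℝ => lam ^ (-((N + 1 : ℝ) / m))) := by
  refine ⟨fun p hp => ⟨⟨bijOn_lambertPhi hp, fun y hy =>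
    (contDiffAt_lambertPhi hp hy).contDiffWithinAt, fun y hy =>
      ⟨lambertPhi_mul_exp hp hy, hasDerivAt_lambertPhi hp hy⟩⟩, hasOscIntegral_genFresnel hs hp,
    fun N _ => (isBigO_lambert_halfLine ha hsupp hs hp N).trans ?_⟩,
    fun m hm hm' N _ => isBigO_lambert_line ha hsupp hs hm hm' N⟩
  -- The exponent obtained is `(N + 1)/p`; as `p - ⌊p⌋ ≥ 0`, it implies the stated bound for `λ ≥
  -- 1`.
  refine IsBigO.of_bound 1 ?_
  filter_upwards [eventually_ge_atTop 1] with lam hlam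
  rw [one_mul, Real.norm_of_nonneg (by positivity), Real.norm_of_nonneg (by positivity)]
  refine Real.rpow_le_rpow_of_exponent_le hlam (neg_le_neg ?_)
  gcongr
  linarith [Int.floor_le p]
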